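/- **Theorem 3 (Upper bound for ICL risk with biased labels).** *Pretraining.* Fix $d,M\in\mathbb N$, weights $0<\pi_m<1$ with $\sum_{m=1}^M\pi_m=1$, centers $\mu_m,w_m\in\mathbb R^d$ with $\|\mu_m\|=\|w_m\|=1$, and $\sigma_x,\sigma_y>0$. For $\sigma_\mu,\sigma_w>0$, a pretraining sequence of length $K$ is generated by drawing a task $(\mu,w)$ from the prior $\sum_{m}\pi_m\,\mathcal N(\mu_m,\sigma_\mu^2I)\otimes\mathcal N(w_m,\sigma_w^2I)$ and then $K$ i.i.d. samples $x_i\sim\mathcal N(\mu,\sigma_x^2I)$, $y_i\mid x_i\sim\mathcal N(\langle w,x_i\rangle,\sigma_y^2)$. Write $\delta_\mu=\sigma_\mu^2/\sigma_x^2$, $\delta_w=\sigma_w^2/\sigma_y^2$, and $S_k\oplus x_{k+1}=[x_1,y_1,\dots,x_k,y_k,x_{k+1}]$. Let $\mathcal F$ be an optimally pretrained (Bayes-optimal) predictor, i.e. a predictor, continuous in $S_k\oplus x_{k+1}$ for each $k$, that for every $K\ge1$ minimizes the pretraining risk $\mathbb E\big[\frac1K\sum_{k=0}^{K-1}(\mathcal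 F(S_k\oplus x_{k+1})-y_{k+1})^2\big]$ among all measurable predictors. *Prompt.* The in-context examples satisfy $x_i\sim\mathcal N(\mu^*,\tau_x^2I)$ i.i.d. and $y_i=\langle x_i,w^*\rangle$, with $\|\mu^*\|=\|w^*\|=1$ and $\tau_x>0$. Let $\alpha\in\{1,\dots,M\}$ with $w^*\ne w_\alpha$, and suppose that for some $d_\mu,d_w,u_w>0$ and all $\beta\neq\alpha$: $\|\mu_\beta-\mu^*\|^2-\|\mu_\alpha-\mu^*\|^2\ge d_\mu^2$, $\|w_\beta-w^*\|^2-\|w_\alpha-w^*\|^2\ge d_w^2$, and $\tau_x^2\|w_\beta-w^*\|^2-(1+\tau_x^2)\|w_\alpha-w^*\|^2\ge\tau_x^2u_w^2$. Let $\mathcal L_k^\alpha=(\mathcal F(S_k\oplus x_{k+1})-\langle x_{k+1},w_\alpha\rangle)^2$. *Conclusion.* There are constants $C_1,C_2,C_3,C_4>0$, depending on $d$, $M$, the $\pi_m,\mu_m,w_m$, $\sigma_x,\sigma_y$, $\tau_x$, $(\mu^*,w^*)$, $\alpha$ and the margins $d_\mu,d_w,u_w$, but not on $\sigma_\mu,\sigma_w$,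 such that: 1. for all $\sigma_\mu,\sigma_w>0$, every such $\mathcal F$ and every $\delta\in(0,\tfrac12)$, as $k\to\infty$, $$\mathbb E[\mathcal L_k^\alpha]<\|w_\alpha-w^*\|^2(1+d\tau_x^2)+\frac{C_1}{k\delta_w}\exp\!\big(C_2k^{\frac\delta2-\frac34}\big)+O(k^{-2});$$ 2. for all $\sigma_\mu,\sigma_w>0$, every such $\mathcal F$ and every integer $k$ in the interval $0\le k\le\min\{\frac1{\delta_\mu}-1,\frac1{\delta_w\tau_x^2}\}$, $$\mathbb E[\mathcal L_k^\alpha]<\|w_\alpha-w^*\|^2(1+d\tau_x^2)\min\{1,4k^2\delta_w^2(1+\tau_x^2)^2\}+C_3\exp\!\Big(-k\Big(\frac{d_\mu^2}{8\sigma_x^2}+\frac{u_w^2\tau_x^2}{8\sigma_y^2}\Big)\Big)+C_4\exp\!\Big(-\frac{k^{1/2}}8\Big);$$ 3. (bounded efficacy) for every $N$, if $\delta_\mu$ and $\delta_w$ are sufficiently small, the interval in 2 contains all integers $0\le k\le N$, and for these $k$ the sum of the two exponentially decaying terms in 2 exceeds the first term; for all $\sigma_w>0$ the first term is non-decreasing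 in $k$ and exceeds the sum of the other two for all sufficiently large $k$. -/

import Mathlib

open MeasureTheory ProbabilityTheory Filter Asymptotics
open scoped ENNReal

noncomputable section

namespace ICL

/-- `ℝ^d` with the Euclidean norm. -/
abbrev Vec (d : ℕ) : Type := EuclideanSpace ℝ (Fin d)

/-- The isotropic normal distribution `N(m, s² I)` on `ℝ^d`. -/
def isoGaussian {d : ℕ} (m : Vec d) (s : ℝ) : Measure (Vec d) :=
  multivariateGaussian m (s ^ 2 • (1 : Matrix (Fin d) (Fin d) ℝ))

/-- The task prior: the Gaussian mixture over tasks `(μ, w)` with weights `p m`, centers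
`(μc m, wc m)` and component laws `N(μc m, σμ² I) ⊗ N(wc m, σw² I)`. -/
def taskPrior {d M : ℕ} (p : Fin M → ℝ) (μc wc : Fin M → Vec d) (σμ σw : ℝ) :
    Measure (Vec d × Vec d) :=
  ∑ m, ENNReal.ofReal (p m) • (isoGaussian (μc m) σμ).prod (isoGaussian (wc m) σw)

/-- The law of one labeled sample `(x, y)` of the task `t = (μ, w)`:
`x ∼ N(μ, σx² I)` and `y ∣ x ∼ N(⟨w, x⟩, σy²)`. -/
def taskLaw {d : ℕ} (σx σy : ℝ) (t : Vec d × Vec d) : Measure (Vec d × ℝ) :=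
  ((isoGaussian t.1 σx).prod (gaussianReal 0 (σy ^ 2).toNNReal)).map
    fun q => (q.1, inner ℝ t.2 q.1 + q.2)

/-- A next-token predictor: `F k S x` is the label predicted for the query `x` after the `k`
labeled samples `S`. -/
abbrev Predictor (d : ℕ) : Type := (k : ℕ) → (Fin k → Vec d × ℝ) → Vec d → ℝ

/-- The pretraining risk `E[(1/K) ∑_{k<K} (F(S_k ⊕ x_{k+1}) - y_{k+1})²]`: a task is drawn from
the prior, then `K` labeled samples are drawn i.i.d. from the task. -/
def pretrainRisk {d : ℕ} (prior : Measure (Vec d × Vec d)) (σx σy : ℝ) (K : ℕ)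
    (F : Predictor d) : ℝ≥0∞ :=
  ∫⁻ t, ∫⁻ S : Fin K → Vec d × ℝ,
      ENNReal.ofReal ((1 / (K : ℝ)) * ∑ k : Fin K,
        (F k (fun i : Fin k => S (Fin.castLE k.isLt.le i)) (S k).1 - (S k).2) ^ 2)
    ∂(Measure.pi fun _ => taskLaw σx σy t) ∂prior

/-- `F` attains the optimal pretraining risk, for every sequence length `K`, among all measurable
predictors. Minimality alone fixes `F` only almost everywhere for the pretraining law, which gives
no mass to noiselessly labeled prompts, so `F` is required to be the continuous version. -/
structure IsOptimalPredictor {d : ℕ} (prior : Measure (Vec d × Vec d)) (σx σy : ℝ)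
    (F : Predictor d) : Prop where
  continuous : ∀ k, Continuous fun q : (Fin k → Vec d × ℝ) × Vec d => F k q.1 q.2
  optimal : ∀ K : ℕ, 0 < K → ∀ G : Predictor d,
    (∀ k, Measurable fun q : (Fin k → Vec d × ℝ) × Vec d => G k q.1 q.2) →
      pretrainRisk prior σx σy K F ≤ pretrainRisk prior σx σy K G

/-- The in-context risk measured against the function `v`: the inputs `x_1, …, x_{k+1}` are i.i.d.
`N(μs, τ² I)`, the prompt labels are `y_i = ⟨x_i, ws⟩`, and the risk is
`E[(F(S_k ⊕ x_{k+1}) - ⟨x_{k+1}, v⟩)²]`. -/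
def iclRisk {d : ℕ} (F : Predictor d) (μs ws : Vec d) (τ : ℝ) (v : Vec d) (k : ℕ) : ℝ≥0∞ :=
  ∫⁻ x : Fin (k + 1) → Vec d,
    ENNReal.ofReal ((F k (fun i => (x i.castSucc, inner ℝ (x i.castSucc) ws)) (x (Fin.last k))
      - inner ℝ (x (Fin.last k)) v) ^ 2)
    ∂(Measure.pi fun _ => isoGaussian μs τ)

/-- The non-decreasing term `‖e‖² (1 + d τ²) min {1, 4 k² δw² (1 + τ²)²}`. -/
def risingTerm {d : ℕ} (e : Vec d) (τ δw : ℝ) (k : ℕ) : ℝ :=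
  ‖e‖ ^ 2 * (1 + d * τ ^ 2) * min 1 (4 * (k : ℝ) ^ 2 * δw ^ 2 * (1 + τ ^ 2) ^ 2)

/-- The two exponentially decaying terms
`C₃ exp (-k (dμ² / (8 σx²) + uw² τ² / (8 σy²))) + C₄ exp (-k^{1/2} / 8)`. -/
def decayingTerms (C₃ C₄ dμ uw σx σy τ : ℝ) (k : ℕ) : ℝ :=
  C₃ * Real.exp (-(k : ℝ) * (dμ ^ 2 / (8 * σx ^ 2) + uw ^ 2 * τ ^ 2 / (8 * σy ^ 2))) +
    C₄ * Real.exp (-(k : ℝ) ^ (1 / 2 : ℝ) / 8)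

end ICL

end

/-! The pretraining risk of `F` is, stage by stage, `∫ evidence · (F - Bayes)²` plus a constant, and
the evidence is continuous and positive. A continuous minimizer therefore equals the Bayes predictor
at every prompt, including the noiselessly labeled ones, a null set. There, completing the square
gives the prediction `⟨w* + ∑ₘ qₘ uₘ, x⟩`, where `uₘ` is `w_m - w*` shrunk by ridge regression on
the prompt with parameter `δw = σw² / σy²` and the `qₘ` are Gibbs weights.

By Chernoff bounds, the sample mean and second moments concentrate outside an event of exponentially
small probability. Off this event, on short prompts the energy of `α` is the smallest by a margin
linear in `k`, so that `q_α` is exponentially close to `1`, and `u_α` differs from `w_α - w*` by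
`O(k δw)`; on long prompts shrinkage alone gives `uₘ = O(1 / (k δw))`. On the exceptional event, an
error bounded by `b ‖x‖²` is split by `2 ‖x‖² ≤ l + ‖x‖⁴ / l` with `l = exp (√k / 8)`, which
produces the term `exp (-√k / 8)`. -/

noncomputable section

namespace ICL

section GaussianMoments

lemma zero_mem_interior_integrableExpSet_of_isGaussian {E : Type*} [NormedAddCommGroup E]
    [NormedSpace ℝ E] [CompleteSpace E] [SecondCountableTopology E] [MeasurableSpace E]
    [BorelSpace E] (ν : Measure E) [IsGaussian ν] {f : E → ℝ} (hf : Measurable f) {A : ℝ}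
    (hA : ∀ x, |f x| ≤ A * (1 + ‖x‖ ^ 2)) :
    0 ∈ interior (integrableExpSet f ν) := by
  obtain ⟨C, hC, hint⟩ := IsGaussian.exists_integrable_exp_sq ν
  have hA0 : 0 ≤ A := by simpa using (abs_nonneg (f 0)).trans (hA 0)
  rw [mem_interior_iff_mem_nhds]
  filter_upwards [Metric.closedBall_mem_nhds (0 : ℝ) (by positivity : 0 < C / (A + 1))] with t ht
  replace ht : |t| ≤ C / (A + 1) := by simpa using ht
  refine (hint.const_mul (Real.exp C)).mono' (by fun_prop) (ae_of_all _ fun x => ?_)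
  rw [Real.norm_eq_abs, Real.abs_exp, ← Real.exp_add, Real.exp_le_exp]
  calc t * f x ≤ |t| * |f x| := (le_abs_self _).trans_eq (abs_mul _ _)
    _ ≤ C / (A + 1) * ((A + 1) * (1 + ‖x‖ ^ 2)) := by
        gcongr
        exact (hA x).trans (by gcongr; linarith)
    _ = C + C * ‖x‖ ^ 2 := by field_simp

variable {d : ℕ}

instance isGaussian_isoGaussian (m : Vec d) (s : ℝ) : IsGaussian (isoGaussian m s) := by
  unfold isoGaussian; infer_instance

lemma posSemidef_sq_smul_one (s : ℝ) :
    (s ^ 2 • (1 : Matrix (Fin d) (Fin d) ℝ)).PosSemidef :=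
  Matrix.PosSemidef.one.smul (sq_nonneg s)

lemma memLp_inner_isoGaussian (m a : Vec d) (s : ℝ) :
    MemLp (fun x => inner ℝ a x) 2 (isoGaussian m s) :=
  (IsGaussian.memLp_two_id (μ := isoGaussian m s)).const_inner a

lemma integrable_inner_mul_inner (m a b : Vec d) (s : ℝ) :
    Integrable (fun x => inner ℝ a x * inner ℝ b x) (isoGaussian m s) :=
  (memLp_inner_isoGaussian m a s).integrable_mul (memLp_inner_isoGaussian m b s)

lemma integral_inner_isoGaussian (m a : Vec d) (s : ℝ) :
    ∫ x, inner ℝ a x ∂(isoGaussian m s) = inner ℝ a m := by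
  rw [integral_inner IsGaussian.integrable_fun_id]
  simp [isoGaussian]

lemma covarianceBilin_isoGaussian (m a b : Vec d) (s : ℝ) :
    covarianceBilin (isoGaussian m s) a b = s ^ 2 * inner ℝ a b := by
  rw [isoGaussian, covarianceBilin_multivariateGaussian (posSemidef_sq_smul_one s)]
  simp [Matrix.smul_mulVec, PiLp.inner_apply, dotProduct, Finset.mul_sum, mul_comm, mul_left_comm]

lemma integral_inner_mul_inner (m a b : Vec d) (s : ℝ) :
    ∫ x, inner ℝ a x * inner ℝ b x ∂(isoGaussian m s) =
      s ^ 2 * inner ℝ a b + inner ℝ a m * inner ℝ b m := by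
  have hcov := covariance_eq_sub (memLp_inner_isoGaussian m a s) (memLp_inner_isoGaussian m b s)
  rw [← covarianceBilin_apply_eq_cov IsGaussian.memLp_two_id, covarianceBilin_isoGaussian,
    integral_inner_isoGaussian, integral_inner_isoGaussian] at hcov
  simp only [Pi.mul_apply] at hcov
  linarith

lemma integrable_norm_pow_isoGaussian (m : Vec d) (s : ℝ) (n : ℕ) :
    Integrable (fun x => ‖x‖ ^ n) (isoGaussian m s) := by
  simpa using (IsGaussian.memLp_id (isoGaussian m s) n (by simp)).integrable_norm_pow'

lemma integral_norm_sq_isoGaussian (m : Vec d) (s : ℝ) :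
    ∫ x, ‖x‖ ^ 2 ∂(isoGaussian m s) = ‖m‖ ^ 2 + d * s ^ 2 := by
  have hsum (x : Vec d) := (EuclideanSpace.basisFun (Fin d) ℝ).sum_sq_inner_right x
  simp_rw [← hsum, sq (inner ℝ _ _)]
  rw [integral_finsetSum _ fun i _ => integrable_inner_mul_inner _ _ _ _]
  simp_rw [integral_inner_mul_inner, Finset.sum_add_distrib]
  simp [add_comm]

end GaussianMoments

section ProductDensities

lemma lintegral_fin_nat_prod_eq_prod {n : ℕ} {E : Type*} [MeasurableSpace E] {ν : Fin n → Measure E}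
    [∀ i, SigmaFinite (ν i)] {f : Fin n → E → ℝ≥0∞} (hf : ∀ i, Measurable (f i)) :
    ∫⁻ x, ∏ i, f i (x i) ∂(Measure.pi ν) = ∏ i, ∫⁻ z, f i z ∂(ν i) := by
  induction n with
  | zero => simp
  | succ n ih =>
    calc ∫⁻ x, ∏ i, f i (x i) ∂(Measure.pi ν)
        = ∫⁻ z : E × (Fin n → E), f 0 z.1 * ∏ i : Fin n, f i.succ (z.2 i)
            ∂((ν 0).prod (Measure.pi fun i => ν i.succ)) := by
          rw [← (measurePreserving_piFinSuccAbove ν 0).symm.lintegral_comp_emb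
            (MeasurableEquiv.measurableEmbedding _)]
          simp_rw [MeasurableEquiv.piFinSuccAbove_symm_apply, Fin.insertNthEquiv,
            Fin.prod_univ_succ, Fin.insertNth_zero, Equiv.coe_fn_mk, Fin.cons_succ,
            Fin.zero_succAbove, cast_eq, Fin.cons_zero]
      _ = ∏ i, ∫⁻ z, f i z ∂(ν i) := by
          rw [lintegral_prod_mul (hf 0).aemeasurable (g := fun x : Fin n → E => ∏ i, f i.succ (x i))
            (Finset.measurable_prod _ fun i _ => (hf _).comp (measurable_pi_apply i)).aemeasurable,
            ih fun i => hf _, Fin.prod_univ_succ]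

lemma lintegral_fintype_prod_eq_prod {ι E : Type*} [Fintype ι] [MeasurableSpace E]
    {ν : ι → Measure E} [∀ i, SigmaFinite (ν i)] {f : ι → E → ℝ≥0∞} (hf : ∀ i, Measurable (f i)) :
    ∫⁻ x, ∏ i, f i (x i) ∂(Measure.pi ν) = ∏ i, ∫⁻ z, f i z ∂(ν i) := by
  let e := (Fintype.equivFin ι).symm
  rw [← (measurePreserving_piCongrLeft ν e).lintegral_comp_emb
    (MeasurableEquiv.measurableEmbedding _)]
  simp_rw [← e.prod_comp, MeasurableEquiv.coe_piCongrLeft, Equiv.piCongrLeft_apply_apply]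
  exact lintegral_fin_nat_prod_eq_prod fun i => hf _

lemma pi_withDensity {ι E : Type*} [Fintype ι] [MeasurableSpace E] {ν : ι → Measure E}
    [∀ i, SigmaFinite (ν i)] {f : ι → E → ℝ≥0∞}
    (hf : ∀ i, Measurable (f i)) [∀ i, SigmaFinite ((ν i).withDensity (f i))] :
    Measure.pi (fun i => (ν i).withDensity (f i)) =
      (Measure.pi ν).withDensity fun x => ∏ i, f i (x i) := by
  refine Measure.pi_eq fun s hs => ?_
  have hbox : (Set.univ.pi s).indicator (fun x : ι → E => ∏ i, f i (x i)) =
      fun x => ∏ i, (s i).indicator (f i) (x i) := by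
    ext x
    by_cases hx : ∀ i, x i ∈ s i
    · rw [Set.indicator_of_mem (Set.mem_univ_pi.2 hx)]
      exact Finset.prod_congr rfl fun i _ => (Set.indicator_of_mem (hx i) _).symm
    · rw [Set.indicator_of_notMem (mt Set.mem_univ_pi.1 hx)]
      obtain ⟨i, hi⟩ := not_forall.1 hx
      exact (Finset.prod_eq_zero (Finset.mem_univ i) (Set.indicator_of_notMem hi _)).symm
  rw [withDensity_apply _ (.univ_pi hs), ← lintegral_indicator (.univ_pi hs), hbox,
    lintegral_fintype_prod_eq_prod fun i => (hf i).indicator (hs i)]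
  exact Finset.prod_congr rfl fun i _ => by
    rw [lintegral_indicator (hs i), withDensity_apply _ (hs i)]

end ProductDensities

section GaussianDensity

lemma integral_exp_neg_mul_norm_sq_mul_cexp_inner {V : Type*} [NormedAddCommGroup V]
    [InnerProductSpace ℝ V] [FiniteDimensional ℝ V] [MeasurableSpace V] [BorelSpace V] {b : ℝ}
    (hb : 0 < b) (t : V) :
    ∫ v : V, (Real.exp (-b * ‖v‖ ^ 2) : ℂ) * Complex.exp (inner ℝ v t * Complex.I) =
      (∫ v : V, Real.exp (-b * ‖v‖ ^ 2) : ℝ) * Complex.exp (-‖t‖ ^ 2 / (4 * b)) := by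
  have hb' : 0 < (b : ℂ).re := by simpa using hb
  have hfourier := GaussianFourier.integral_cexp_neg_mul_sq_norm_add hb' Complex.I t
  rw [Complex.I_sq, neg_one_mul, ← GaussianFourier.integral_cexp_neg_mul_sq_norm hb'] at hfourier
  rw [← integral_complex_ofReal]
  convert hfourier using 2
  · ext v
    rw [Complex.ofReal_exp, ← Complex.exp_add, real_inner_comm]
    push_cast
    ring_nf
  · simp

variable {d : ℕ}

/-- The density of `N(m, s² I)` with respect to the Lebesgue measure, for `0 < s`. -/
def isoDensity (m : Vec d) (s : ℝ) (x : Vec d) : ℝ :=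
  ((2 * Real.pi * s ^ 2) ^ (d / 2 : ℝ))⁻¹ * Real.exp (-(1 / (2 * s ^ 2)) * ‖x - m‖ ^ 2)

lemma isoDensity_pos {s : ℝ} (hs : 0 < s) (m x : Vec d) : 0 < isoDensity m s x := by
  unfold isoDensity; positivity

@[fun_prop]
lemma continuous_isoDensity {X : Type*} [TopologicalSpace X] {f g : X → Vec d}
    (hf : Continuous f) (hg : Continuous g) (s : ℝ) :
    Continuous fun x => isoDensity (f x) s (g x) := by
  unfold isoDensity; fun_prop

lemma integral_exp_neg_norm_sq_div {s : ℝ} (hs : 0 < s) :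
    ∫ v : Vec d, Real.exp (-(1 / (2 * s ^ 2)) * ‖v‖ ^ 2) =
      (2 * Real.pi * s ^ 2) ^ (d / 2 : ℝ) := by
  rw [GaussianFourier.integral_rexp_neg_mul_sq_norm (by positivity), finrank_euclideanSpace_fin]
  congr 1
  field_simp

lemma integrable_isoDensity {s : ℝ} (hs : 0 < s) (m : Vec d) : Integrable (isoDensity m s) := by
  have hint : Integrable fun v : Vec d => Real.exp (-(1 / (2 * s ^ 2)) * ‖v‖ ^ 2) :=
    .of_integral_ne_zero (by rw [integral_exp_neg_norm_sq_div hs]; positivity)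
  exact (hint.comp_sub_right m).const_mul _

lemma charFun_isoGaussian (m t : Vec d) (s : ℝ) :
    charFun (isoGaussian m s) t =
      Complex.exp (inner ℝ t m * Complex.I - s ^ 2 * ‖t‖ ^ 2 / 2) := by
  have hquad : (t : Fin d → ℝ) ⬝ᵥ (s ^ 2 • (1 : Matrix (Fin d) (Fin d) ℝ)).mulVec t
      = s ^ 2 * ‖t‖ ^ 2 := by
    rw [Matrix.smul_mulVec, Matrix.one_mulVec, dotProduct_smul, EuclideanSpace.real_norm_sq_eq]
    simp [dotProduct, sq]
  rw [isoGaussian, charFun_multivariateGaussian (posSemidef_sq_smul_one s), hquad]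
  push_cast
  rfl

lemma integral_isoDensity_smul_cexp_inner (m t : Vec d) {s : ℝ} (hs : 0 < s) :
    ∫ x, isoDensity m s x • Complex.exp (inner ℝ x t * Complex.I) =
      Complex.exp (inner ℝ t m * Complex.I - s ^ 2 * ‖t‖ ^ 2 / 2) := by
  set Z : ℝ := (2 * Real.pi * s ^ 2) ^ (d / 2 : ℝ) with hZ_eq
  have hZ : (Z : ℂ) ≠ 0 := Complex.ofReal_ne_zero.2 (by positivity)
  have hshift (v : Vec d) :
      isoDensity m s (v + m) • Complex.exp (inner ℝ (v + m) t * Complex.I) =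
        (Z : ℂ)⁻¹ * Complex.exp (inner ℝ t m * Complex.I) *
          ((Real.exp (-(1 / (2 * s ^ 2)) * ‖v‖ ^ 2) : ℂ) *
            Complex.exp (inner ℝ v t * Complex.I)) := by
    rw [isoDensity, ← hZ_eq, add_sub_cancel_right, Complex.real_smul, inner_add_left,
      real_inner_comm t m, Complex.ofReal_add, add_mul, Complex.exp_add]
    push_cast
    ring
  have hexponent : -(‖t‖ : ℂ) ^ 2 / (4 * (1 / (2 * s ^ 2) : ℝ)) = -(s ^ 2 * ‖t‖ ^ 2 / 2) := by
    push_cast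
    field_simp
    norm_num
  rw [← integral_add_right_eq_self _ m]
  simp_rw [hshift]
  rw [integral_const_mul, integral_exp_neg_mul_norm_sq_mul_cexp_inner (by positivity),
    integral_exp_neg_norm_sq_div hs, ← hZ_eq, hexponent, sub_eq_add_neg, Complex.exp_add]
  field_simp

lemma isoGaussian_eq_withDensity (m : Vec d) {s : ℝ} (hs : 0 < s) :
    isoGaussian m s = volume.withDensity fun x => ENNReal.ofReal (isoDensity m s x) := by
  have : IsFiniteMeasure (volume.withDensity fun x => ENNReal.ofReal (isoDensity m s x)) :=
    isFiniteMeasure_withDensity_ofReal (integrable_isoDensity hs m).2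
  refine Measure.ext_of_charFun (funext fun t => ?_)
  rw [charFun_isoGaussian, charFun_apply,
    integral_withDensity_eq_integral_toReal_smul (by fun_prop) (by simp)]
  simp_rw [ENNReal.toReal_ofReal (isoDensity_pos hs m _).le]
  exact (integral_isoDensity_smul_cexp_inner m t hs).symm

end GaussianDensity

section TaskDensity

variable {d : ℕ}

lemma lintegral_isoGaussian {s : ℝ} (hs : 0 < s) (m : Vec d) (g : Vec d → ℝ≥0∞) :
    ∫⁻ x, g x ∂(isoGaussian m s) = ∫⁻ x, ENNReal.ofReal (isoDensity m s x) * g x := by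
  rw [isoGaussian_eq_withDensity _ hs, lintegral_withDensity_eq_lintegral_mul_non_measurable _
    (by fun_prop) (ae_of_all _ fun _ => ENNReal.ofReal_lt_top)]
  rfl

lemma lintegral_gaussianReal (m : ℝ) {v : NNReal} (hv : v ≠ 0) (g : ℝ → ℝ≥0∞) :
    ∫⁻ y, g y ∂(gaussianReal m v) = ∫⁻ y, gaussianPDF m v y * g y := by
  rw [gaussianReal_of_var_ne_zero _ hv, lintegral_withDensity_eq_lintegral_mul_non_measurable _
    (measurable_gaussianPDF _ _) (ae_of_all _ fun _ => gaussianPDF_lt_top)]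
  rfl

lemma lintegral_ofReal_sub_sq_gaussianReal (a m : ℝ) (v : NNReal) :
    ∫⁻ y, ENNReal.ofReal ((a - y) ^ 2) ∂(gaussianReal m v) = ENNReal.ofReal ((a - m) ^ 2 + v) := by
  have hmem : MemLp (fun y : ℝ => a - y) 2 (gaussianReal m v) :=
    (memLp_const a).sub IsGaussian.memLp_two_id
  have hmean : ∫ y, (a - y) ∂(gaussianReal m v) = a - m := by
    rw [integral_sub (integrable_const _) IsGaussian.integrable_fun_id]
    simp
  have hvar : Var[fun y => a - y; gaussianReal m v] = v := by
    rw [variance_const_sub (X := fun y : ℝ => y) (by fun_prop), variance_fun_id_gaussianReal]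
  have hsplit := variance_eq_sub hmem
  rw [hvar, hmean] at hsplit
  rw [← ofReal_integral_eq_lintegral_ofReal hmem.integrable_sq (ae_of_all _ fun _ => sq_nonneg _)]
  congr 1
  simp only [Pi.pow_apply] at hsplit
  linarith

/-- The density of `taskLaw σx σy t` with respect to the Lebesgue measure. -/
def sampleDensity (σx σy : ℝ) (t : Vec d × Vec d) (z : Vec d × ℝ) : ℝ :=
  isoDensity t.1 σx z.1 * gaussianPDFReal (inner ℝ t.2 z.1) (σy ^ 2).toNNReal z.2

@[fun_prop]
lemma continuous_sampleDensity {X : Type*} [TopologicalSpace X] {f : X → Vec d × Vec d}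
    {g : X → Vec d × ℝ} (hf : Continuous f) (hg : Continuous g) (σx σy : ℝ) :
    Continuous fun x => sampleDensity σx σy (f x) (g x) := by
  unfold sampleDensity gaussianPDFReal; fun_prop

lemma isoDensity_le {s : ℝ} (hs : 0 < s) (m x : Vec d) :
    isoDensity m s x ≤ isoDensity (0 : Vec d) s 0 := by
  have hexponent : 0 ≤ 1 / (2 * s ^ 2) * ‖x - m‖ ^ 2 := by positivity
  refine mul_le_mul_of_nonneg_left (Real.exp_le_exp.2 ?_) (by positivity)
  simpa using hexponent

lemma gaussianPDFReal_le (m : ℝ) (v : NNReal) (y : ℝ) :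
    gaussianPDFReal m v y ≤ gaussianPDFReal 0 v 0 := by
  have hexponent : 0 ≤ (y - m) ^ 2 / (2 * v) := by positivity
  refine mul_le_mul_of_nonneg_left (Real.exp_le_exp.2 ?_) (by positivity)
  simpa [neg_div] using hexponent

lemma sampleDensity_pos {σx σy : ℝ} (hσx : 0 < σx) (hσy : 0 < σy) (t : Vec d × Vec d)
    (z : Vec d × ℝ) : 0 < sampleDensity σx σy t z :=
  mul_pos (isoDensity_pos hσx _ _) (gaussianPDFReal_pos _ _ _ (by simp [hσy.ne']))

lemma sampleDensity_le {σx : ℝ} (hσx : 0 < σx) (σy : ℝ) (t : Vec d × Vec d) (z : Vec d × ℝ) :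
    sampleDensity σx σy t z ≤ sampleDensity σx σy (0 : Vec d × Vec d) 0 := by
  unfold sampleDensity
  refine mul_le_mul (isoDensity_le hσx _ _) ?_ (gaussianPDFReal_nonneg _ _ _)
    (isoDensity_pos hσx _ _).le
  simpa using gaussianPDFReal_le (inner ℝ t.2 z.1) (σy ^ 2).toNNReal z.2

instance isProbabilityMeasure_taskLaw (σx σy : ℝ) (t : Vec d × Vec d) :
    IsProbabilityMeasure (taskLaw σx σy t) :=
  Measure.isProbabilityMeasure_map (by fun_prop)

lemma lintegral_taskLaw (σx σy : ℝ) (t : Vec d × Vec d) {f : Vec d × ℝ → ℝ≥0∞}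
    (hf : Measurable f) :
    ∫⁻ z, f z ∂(taskLaw σx σy t) =
      ∫⁻ x, ∫⁻ y, f (x, y) ∂(gaussianReal (inner ℝ t.2 x) (σy ^ 2).toNNReal)
        ∂(isoGaussian t.1 σx) := by
  have hlabel : Measurable fun q : Vec d × ℝ => (q.1, inner ℝ t.2 q.1 + q.2) := by fun_prop
  rw [taskLaw, lintegral_map hf hlabel, lintegral_prod _ (by fun_prop)]
  refine lintegral_congr fun x => ?_
  have hshift := gaussianReal_map_const_add (μ := 0) (v := (σy ^ 2).toNNReal) (inner ℝ t.2 x)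
  rw [zero_add] at hshift
  rw [← hshift, lintegral_map (by fun_prop) (by fun_prop)]

lemma taskLaw_eq_withDensity {σx σy : ℝ} (hσx : 0 < σx) (hσy : 0 < σy) (t : Vec d × Vec d) :
    taskLaw σx σy t = volume.withDensity fun z => ENNReal.ofReal (sampleDensity σx σy t z) := by
  have hdens : Measurable fun z => ENNReal.ofReal (sampleDensity σx σy t z) :=
    (continuous_sampleDensity continuous_const continuous_id _ _).measurable.ennreal_ofReal
  refine Measure.ext_of_lintegral _ fun f hf => ?_
  rw [lintegral_taskLaw _ _ _ hf, lintegral_isoGaussian hσx,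
    lintegral_withDensity_eq_lintegral_mul _ hdens hf, Measure.volume_eq_prod,
    lintegral_prod _ (hdens.mul hf).aemeasurable]
  refine lintegral_congr fun x => ?_
  rw [lintegral_gaussianReal _ (by simp [hσy.ne']), ← lintegral_const_mul _
    (f := fun y => gaussianPDF _ _ y * f (x, y)) (by fun_prop)]
  refine lintegral_congr fun y => ?_
  rw [Pi.mul_apply, sampleDensity, ENNReal.ofReal_mul (isoDensity_pos hσx _ _).le, mul_assoc,
    gaussianPDF]

lemma lintegral_pi_taskLaw {σx σy : ℝ} (hσx : 0 < σx) (hσy : 0 < σy) (t : Vec d × Vec d)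
    {ι : Type*} [Fintype ι] {g : (ι → Vec d × ℝ) → ℝ≥0∞} (hg : Measurable g) :
    ∫⁻ S, g S ∂(Measure.pi fun _ => taskLaw σx σy t) =
      ∫⁻ S, ENNReal.ofReal (∏ i, sampleDensity σx σy t (S i)) * g S := by
  have hdens : Measurable fun z => ENNReal.ofReal (sampleDensity σx σy t z) :=
    (continuous_sampleDensity continuous_const continuous_id _ _).measurable.ennreal_ofReal
  have : SigmaFinite (volume.withDensity fun z => ENNReal.ofReal (sampleDensity σx σy t z)) := by
    rw [← taskLaw_eq_withDensity hσx hσy]; infer_instance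
  rw [taskLaw_eq_withDensity hσx hσy, pi_withDensity fun _ => hdens,
    lintegral_withDensity_eq_lintegral_mul _ (by fun_prop) hg]
  simp_rw [ENNReal.ofReal_prod_of_nonneg fun _ _ => (sampleDensity_pos hσx hσy t _).le]
  rfl

lemma measurable_lintegral_pi_taskLaw {σx σy : ℝ} (hσx : 0 < σx) (hσy : 0 < σy) {ι : Type*}
    [Fintype ι] {g : (ι → Vec d × ℝ) → ℝ≥0∞} (hg : Measurable g) :
    Measurable fun t : Vec d × Vec d =>
      ∫⁻ S, g S ∂(Measure.pi fun _ => taskLaw σx σy t) := by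
  simp_rw [lintegral_pi_taskLaw hσx hσy _ hg]
  refine Measurable.lintegral_prod_right' (f := fun p : (Vec d × Vec d) × (ι → Vec d × ℝ) =>
    ENNReal.ofReal (∏ i, sampleDensity σx σy p.1 (p.2 i)) * g p.2) ?_
  refine Measurable.mul (Measurable.ennreal_ofReal ?_) (hg.comp measurable_snd)
  exact Continuous.measurable (by fun_prop)

/-- The density of `(S, x)` for a prompt `S` of labeled samples and a query `x` of the task `t`. -/
def likelihood (σx σy : ℝ) (t : Vec d × Vec d) {k : ℕ} (q : (Fin k → Vec d × ℝ) × Vec d) : ℝ :=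
  (∏ i, sampleDensity σx σy t (q.1 i)) * isoDensity t.1 σx q.2

lemma likelihood_pos {σx σy : ℝ} (hσx : 0 < σx) (hσy : 0 < σy) (t : Vec d × Vec d) {k : ℕ}
    (q : (Fin k → Vec d × ℝ) × Vec d) : 0 < likelihood σx σy t q :=
  mul_pos (Finset.prod_pos fun _ _ => sampleDensity_pos hσx hσy _ _) (isoDensity_pos hσx _ _)

lemma likelihood_le {σx σy : ℝ} (hσx : 0 < σx) (hσy : 0 < σy) (t : Vec d × Vec d) {k : ℕ}
    (q : (Fin k → Vec d × ℝ) × Vec d) :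
    likelihood σx σy t q ≤ likelihood σx σy 0 (0 : (Fin k → Vec d × ℝ) × Vec d) :=
  mul_le_mul (Finset.prod_le_prod (fun _ _ => (sampleDensity_pos hσx hσy _ _).le)
      fun _ _ => sampleDensity_le hσx _ _ _) (isoDensity_le hσx _ _) (isoDensity_pos hσx _ _).le
    (Finset.prod_nonneg fun _ _ => (sampleDensity_pos hσx hσy _ _).le)

@[fun_prop]
lemma continuous_likelihood {X : Type*} [TopologicalSpace X] {f : X → Vec d × Vec d} {k : ℕ}
    {g : X → (Fin k → Vec d × ℝ) × Vec d} (hf : Continuous f) (hg : Continuous g) (σx σy : ℝ) :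
    Continuous fun x => likelihood σx σy (f x) (g x) := by
  unfold likelihood; fun_prop

end TaskDensity

section StageRisk

lemma lintegral_pi_fin_succ {Ω : Type*} [MeasurableSpace Ω] (ν : Measure Ω) [SigmaFinite ν]
    {k : ℕ} {f : (Fin k → Ω) × Ω → ℝ≥0∞} (hf : Measurable f) :
    ∫⁻ S : Fin (k + 1) → Ω, f (fun i => S i.castSucc, S (Fin.last k)) ∂(Measure.pi fun _ => ν) =
      ∫⁻ S : Fin k → Ω, ∫⁻ z, f (S, z) ∂ν ∂(Measure.pi fun _ => ν) := by
  have hswap : Measurable fun p : Ω × (Fin k → Ω) => f (p.2, p.1) := hf.comp measurable_swap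
  rw [← lintegral_prod_symm _ hswap.aemeasurable, ← (measurePreserving_piFinSuccAbove
    (fun _ : Fin (k + 1) => ν) (Fin.last k)).lintegral_comp hswap]
  simp [MeasurableEquiv.piFinSuccAbove]
  rfl

variable {d : ℕ}

instance sigmaFinite_volume_sample : SigmaFinite (volume : Measure (Vec d × ℝ)) :=
  inferInstanceAs (SigmaFinite ((volume : Measure (Vec d)).prod volume))

/-- The risk of predicting the label of the sample that follows `k` labeled samples: the `k`-th
term of `pretrainRisk`. -/
def stageRisk (prior : Measure (Vec d × Vec d)) (σx σy : ℝ) {k : ℕ}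
    (f : (Fin k → Vec d × ℝ) × Vec d → ℝ) : ℝ≥0∞ :=
  ∫⁻ t, ∫⁻ S : Fin (k + 1) → Vec d × ℝ,
      ENNReal.ofReal ((f (fun i => S i.castSucc, (S (Fin.last k)).1) - (S (Fin.last k)).2) ^ 2)
    ∂(Measure.pi fun _ => taskLaw σx σy t) ∂prior

lemma lintegral_sub_sq_taskLaw {σx : ℝ} (hσx : 0 < σx) (σy : ℝ) (t : Vec d × Vec d)
    {a : Vec d → ℝ} (ha : Measurable a) :
    ∫⁻ z, ENNReal.ofReal ((a z.1 - z.2) ^ 2) ∂(taskLaw σx σy t) =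
      ∫⁻ x, ENNReal.ofReal (isoDensity t.1 σx x * ((a x - inner ℝ t.2 x) ^ 2 + σy ^ 2)) := by
  rw [lintegral_taskLaw _ _ _ (by fun_prop), lintegral_isoGaussian hσx]
  simp_rw [lintegral_ofReal_sub_sq_gaussianReal, ENNReal.ofReal_mul (isoDensity_pos hσx _ _).le,
    Real.coe_toNNReal _ (sq_nonneg σy)]

lemma lintegral_sub_sq_pi_taskLaw {σx σy : ℝ} (hσx : 0 < σx) (hσy : 0 < σy) (t : Vec d × Vec d)
    {k : ℕ} {f : (Fin k → Vec d × ℝ) × Vec d → ℝ} (hf : Measurable f) :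
    ∫⁻ S : Fin (k + 1) → Vec d × ℝ, ENNReal.ofReal
        ((f (fun i => S i.castSucc, (S (Fin.last k)).1) - (S (Fin.last k)).2) ^ 2)
        ∂(Measure.pi fun _ => taskLaw σx σy t) =
      ∫⁻ q, ENNReal.ofReal (likelihood σx σy t q * ((f q - inner ℝ t.2 q.2) ^ 2 + σy ^ 2)) := by
  rw [lintegral_pi_fin_succ _ (f := fun p : (Fin k → Vec d × ℝ) × (Vec d × ℝ) =>
    ENNReal.ofReal ((f (p.1, p.2.1) - p.2.2) ^ 2)) (by fun_prop)]
  have hstage (S : Fin k → Vec d × ℝ) := lintegral_sub_sq_taskLaw hσx σy t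
    (a := fun x => f (S, x)) (by fun_prop)
  have hinner : Measurable fun p : (Fin k → Vec d × ℝ) × Vec d =>
      ENNReal.ofReal (isoDensity t.1 σx p.2 * ((f p - inner ℝ t.2 p.2) ^ 2 + σy ^ 2)) := by
    fun_prop
  simp_rw [hstage, likelihood]
  rw [lintegral_pi_taskLaw hσx hσy _ hinner.lintegral_prod_right', Measure.volume_eq_prod,
    lintegral_prod _ (by fun_prop)]
  refine lintegral_congr fun S => ?_
  rw [← lintegral_const_mul _ (by fun_prop)]
  refine lintegral_congr fun x => ?_
  rw [mul_assoc, ENNReal.ofReal_mul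
    (Finset.prod_nonneg fun _ _ => (sampleDensity_pos hσx hσy _ _).le)]

lemma stageRisk_eq_lintegral {prior : Measure (Vec d × Vec d)} [SFinite prior] {σx σy : ℝ}
    (hσx : 0 < σx) (hσy : 0 < σy) {k : ℕ} {f : (Fin k → Vec d × ℝ) × Vec d → ℝ}
    (hf : Measurable f) :
    stageRisk prior σx σy f =
      ∫⁻ q, ∫⁻ t, ENNReal.ofReal
        (likelihood σx σy t q * ((f q - inner ℝ t.2 q.2) ^ 2 + σy ^ 2)) ∂prior := by
  rw [lintegral_lintegral_swap (by fun_prop), stageRisk]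
  exact lintegral_congr fun t => lintegral_sub_sq_pi_taskLaw hσx hσy t hf

end StageRisk

section BayesPredictor

variable {d : ℕ}

/-- The marginal density of a prompt and a query when the task is drawn from `prior`. -/
def evidence (prior : Measure (Vec d × Vec d)) (σx σy : ℝ) {k : ℕ}
    (q : (Fin k → Vec d × ℝ) × Vec d) : ℝ :=
  ∫ t, likelihood σx σy t q ∂prior

/-- The integral of the regression vector against the unnormalized posterior. -/
def weightedTask (prior : Measure (Vec d × Vec d)) (σx σy : ℝ) {k : ℕ}
    (q : (Fin k → Vec d × ℝ) × Vec d) : Vec d :=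
  ∫ t, likelihood σx σy t q • t.2 ∂prior

/-- The Bayes predictor: the posterior mean of the label of the query. The noise of the query label
is centered, so this is the posterior mean of `⟨w, x⟩`. -/
def bayesPredictor (prior : Measure (Vec d × Vec d)) (σx σy : ℝ) {k : ℕ}
    (q : (Fin k → Vec d × ℝ) × Vec d) : ℝ :=
  inner ℝ (weightedTask prior σx σy q) q.2 / evidence prior σx σy q

variable {prior : Measure (Vec d × Vec d)} {σx σy : ℝ} {k : ℕ}

lemma norm_likelihood_le (hσx : 0 < σx) (hσy : 0 < σy) (t : Vec d × Vec d)
    (q : (Fin k → Vec d × ℝ) × Vec d) :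
    ‖likelihood σx σy t q‖ ≤ likelihood σx σy 0 (0 : (Fin k → Vec d × ℝ) × Vec d) := by
  rw [Real.norm_of_nonneg (likelihood_pos hσx hσy t q).le]
  exact likelihood_le hσx hσy t q

lemma integrable_likelihood_smul (hσx : 0 < σx) (hσy : 0 < σy)
    (q : (Fin k → Vec d × ℝ) × Vec d) {E : Type*} [NormedAddCommGroup E] [NormedSpace ℝ E]
    {h : Vec d × Vec d → E} (hh : Integrable h prior) :
    Integrable (fun t => likelihood σx σy t q • h t) prior :=
  hh.bdd_smul _ (Continuous.aestronglyMeasurable (by fun_prop))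
    (ae_of_all _ fun t => norm_likelihood_le hσx hσy t q)

lemma integrable_likelihood [IsFiniteMeasure prior] (hσx : 0 < σx) (hσy : 0 < σy)
    (q : (Fin k → Vec d × ℝ) × Vec d) : Integrable (fun t => likelihood σx σy t q) prior := by
  simpa using integrable_likelihood_smul hσx hσy q (integrable_const (1 : ℝ))

lemma evidence_pos [IsProbabilityMeasure prior] (hσx : 0 < σx) (hσy : 0 < σy)
    (q : (Fin k → Vec d × ℝ) × Vec d) : 0 < evidence prior σx σy q := by
  have hsupport : Function.support (fun t => likelihood σx σy t q) = Set.univ :=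
    Set.eq_univ_of_forall fun t => (likelihood_pos hσx hσy t q).ne'
  rw [evidence, integral_pos_iff_support_of_nonneg (fun t => (likelihood_pos hσx hσy t q).le)
    (integrable_likelihood hσx hσy q), hsupport]
  simp

lemma continuous_evidence [IsFiniteMeasure prior] (hσx : 0 < σx) (hσy : 0 < σy) :
    Continuous fun q : (Fin k → Vec d × ℝ) × Vec d => evidence prior σx σy q :=
  continuous_of_dominated (fun q => Continuous.aestronglyMeasurable (by fun_prop))
    (fun q => ae_of_all _ fun t => norm_likelihood_le hσx hσy t q)
    (integrable_const _) (ae_of_all _ fun t => by fun_prop)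

lemma continuous_weightedTask (hσx : 0 < σx) (hσy : 0 < σy)
    (hw : Integrable (fun t => t.2) prior) :
    Continuous fun q : (Fin k → Vec d × ℝ) × Vec d => weightedTask prior σx σy q := by
  refine continuous_of_dominated
    (bound := fun t => likelihood σx σy 0 (0 : (Fin k → Vec d × ℝ) × Vec d) * ‖t.2‖)
    (fun q => Continuous.aestronglyMeasurable (by fun_prop)) (fun q => ae_of_all _ fun t => ?_)
    (hw.norm.const_mul _) (ae_of_all _ fun t => by fun_prop)
  rw [norm_smul]
  exact mul_le_mul_of_nonneg_right (norm_likelihood_le hσx hσy t q) (norm_nonneg _)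

lemma continuous_bayesPredictor [IsProbabilityMeasure prior] (hσx : 0 < σx) (hσy : 0 < σy)
    (hw : Integrable (fun t => t.2) prior) :
    Continuous fun q : (Fin k → Vec d × ℝ) × Vec d => bayesPredictor prior σx σy q :=
  ((continuous_weightedTask hσx hσy hw).inner continuous_snd).div
    (continuous_evidence hσx hσy) fun q => (evidence_pos hσx hσy q).ne'

lemma inner_weightedTask (hσx : 0 < σx) (hσy : 0 < σy) (hw : Integrable (fun t => t.2) prior)
    (q : (Fin k → Vec d × ℝ) × Vec d) (x : Vec d) :
    inner ℝ (weightedTask prior σx σy q) x =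
      ∫ t, likelihood σx σy t q * inner ℝ t.2 x ∂prior := by
  rw [weightedTask, real_inner_comm, ← integral_inner (integrable_likelihood_smul hσx hσy q hw)]
  simp_rw [real_inner_smul_right, real_inner_comm]

lemma inner_weightedTask_eq_evidence_mul_bayesPredictor [IsProbabilityMeasure prior]
    (hσx : 0 < σx) (hσy : 0 < σy) (q : (Fin k → Vec d × ℝ) × Vec d) :
    inner ℝ (weightedTask prior σx σy q) q.2 =
      evidence prior σx σy q * bayesPredictor prior σx σy q := by
  rw [bayesPredictor, mul_div_cancel₀ _ (evidence_pos hσx hσy q).ne']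

lemma integrable_inner_sq (hw : MemLp (fun t => t.2) 2 prior) (x : Vec d) :
    Integrable (fun t => inner ℝ t.2 x ^ 2) prior :=
  (hw.inner_const x).integrable_sq

lemma integrable_likelihood_mul_sub_sq [IsFiniteMeasure prior] (hσx : 0 < σx) (hσy : 0 < σy)
    (hw : MemLp (fun t => t.2) 2 prior) (q : (Fin k → Vec d × ℝ) × Vec d) (a : ℝ) :
    Integrable (fun t => likelihood σx σy t q * ((a - inner ℝ t.2 q.2) ^ 2 + σy ^ 2)) prior :=
  integrable_likelihood_smul hσx hσy q
    (((memLp_const a).sub (hw.inner_const q.2)).integrable_sq.add (integrable_const _))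

lemma integral_likelihood_mul_sub_sq [IsProbabilityMeasure prior] (hσx : 0 < σx) (hσy : 0 < σy)
    (hw : MemLp (fun t => t.2) 2 prior) (q : (Fin k → Vec d × ℝ) × Vec d) (a : ℝ) :
    ∫ t, likelihood σx σy t q * ((a - inner ℝ t.2 q.2) ^ 2 + σy ^ 2) ∂prior =
      evidence prior σx σy q * (a - bayesPredictor prior σx σy q) ^ 2 +
        ∫ t, likelihood σx σy t q *
          ((bayesPredictor prior σx σy q - inner ℝ t.2 q.2) ^ 2 + σy ^ 2) ∂prior := by
  have hlik := integrable_likelihood (prior := prior) hσx hσy q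
  have hw₁ : Integrable (fun t => t.2) prior := hw.integrable one_le_two
  have hfst := integrable_likelihood_smul hσx hσy q (hw₁.inner_const (𝕜 := ℝ) q.2)
  have hsnd := integrable_likelihood_smul hσx hσy q (integrable_inner_sq hw q.2)
  simp only [smul_eq_mul] at hfst hsnd
  have hquadratic (c : ℝ) :
      ∫ t, likelihood σx σy t q * ((c - inner ℝ t.2 q.2) ^ 2 + σy ^ 2) ∂prior =
        evidence prior σx σy q * (c ^ 2 + σy ^ 2) -
          2 * c * inner ℝ (weightedTask prior σx σy q) q.2 +
          ∫ t, likelihood σx σy t q * inner ℝ t.2 q.2 ^ 2 ∂prior := by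
    have hlin := (hlik.mul_const (c ^ 2 + σy ^ 2)).sub (hfst.const_mul (2 * c))
    rw [inner_weightedTask hσx hσy hw₁, evidence, ← integral_mul_const, ← integral_const_mul,
      ← integral_sub (hlik.mul_const _) (hfst.const_mul _), ← integral_add (by exact hlin) hsnd]
    exact integral_congr_ae (ae_of_all _ fun t => by ring)
  rw [hquadratic, hquadratic, inner_weightedTask_eq_evidence_mul_bayesPredictor hσx hσy]
  ring

-- The bias-variance decomposition for the posterior, integrated over prompts and queries.
lemma stageRisk_eq_add [IsProbabilityMeasure prior] (hσx : 0 < σx) (hσy : 0 < σy)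
    (hw : MemLp (fun t => t.2) 2 prior) {f : (Fin k → Vec d × ℝ) × Vec d → ℝ}
    (hf : Measurable f) :
    stageRisk prior σx σy f =
      (∫⁻ q, ENNReal.ofReal (evidence prior σx σy q * (f q - bayesPredictor prior σx σy q) ^ 2)) +
        stageRisk prior σx σy (bayesPredictor prior σx σy (k := k)) := by
  have hbayes := (continuous_bayesPredictor (k := k) hσx hσy (hw.integrable one_le_two)).measurable
  have hevidence := (continuous_evidence (prior := prior) (k := k) hσx hσy).measurable
  have hnonneg (q : (Fin k → Vec d × ℝ) × Vec d) (a : ℝ) (t : Vec d × Vec d) :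
      0 ≤ likelihood σx σy t q * ((a - inner ℝ t.2 q.2) ^ 2 + σy ^ 2) :=
    mul_nonneg (likelihood_pos hσx hσy t q).le (by positivity)
  rw [stageRisk_eq_lintegral hσx hσy hf, stageRisk_eq_lintegral hσx hσy hbayes,
    ← lintegral_add_left (by fun_prop)]
  refine lintegral_congr fun q => ?_
  have hpos := evidence_pos (prior := prior) hσx hσy q
  simp_rw [← ofReal_integral_eq_lintegral_ofReal (integrable_likelihood_mul_sub_sq hσx hσy hw q _)
    (ae_of_all _ (hnonneg q _))]
  rw [integral_likelihood_mul_sub_sq hσx hσy hw,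
    ENNReal.ofReal_add (by positivity) (integral_nonneg (hnonneg q _))]

end BayesPredictor

section Optimality

variable {d : ℕ} {prior : Measure (Vec d × Vec d)} {σx σy : ℝ}

lemma pretrainRisk_succ (hσx : 0 < σx) (hσy : 0 < σy) (k : ℕ) {F : Predictor d}
    (hF : Measurable fun q : (Fin k → Vec d × ℝ) × Vec d => F k q.1 q.2) :
    pretrainRisk prior σx σy (k + 1) F =
      (∫⁻ t, ∫⁻ S : Fin (k + 1) → Vec d × ℝ,
        ENNReal.ofReal ((1 / ((k + 1 : ℕ) : ℝ)) * ∑ j : Fin k,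
          (F j (fun i : Fin j => S (Fin.castLE j.castSucc.isLt.le i)) (S j.castSucc).1 -
            (S j.castSucc).2) ^ 2)
      ∂(Measure.pi fun _ => taskLaw σx σy t) ∂prior) +
      ENNReal.ofReal (1 / ((k + 1 : ℕ) : ℝ)) *
        stageRisk prior σx σy (fun q : (Fin k → Vec d × ℝ) × Vec d => F k q.1 q.2) := by
  have hprompt : Measurable fun S : Fin (k + 1) → Vec d × ℝ =>
      F k (fun i => S i.castSucc) (S (Fin.last k)).1 :=
    hF.comp (f := fun S : Fin (k + 1) → Vec d × ℝ =>
      (fun i : Fin k => S i.castSucc, (S (Fin.last k)).1)) (by fun_prop)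
  have hlast : Measurable fun S : Fin (k + 1) → Vec d × ℝ =>
      ENNReal.ofReal ((F k (fun i => S i.castSucc) (S (Fin.last k)).1 - (S (Fin.last k)).2) ^ 2) :=
    ((hprompt.sub (by fun_prop)).pow_const 2).ennreal_ofReal
  have houter := measurable_lintegral_pi_taskLaw hσx hσy hlast
  rw [stageRisk, ← lintegral_const_mul _ houter, ← lintegral_add_right _ (houter.const_mul _),
    pretrainRisk]
  refine lintegral_congr fun t => ?_
  rw [← lintegral_const_mul _ hlast, ← lintegral_add_right _ (hlast.const_mul _)]
  refine lintegral_congr fun S => ?_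
  rw [Fin.sum_univ_castSucc, mul_add, ENNReal.ofReal_add (by positivity) (by positivity)]
  congr 1
  rw [← ENNReal.ofReal_mul (by positivity)]
  rfl

lemma lintegral_label_sq_le (σx σy : ℝ) (t : Vec d × Vec d) :
    ∫⁻ z, ENNReal.ofReal (z.2 ^ 2) ∂(taskLaw σx σy t) ≤
      ENNReal.ofReal (‖t.2‖ ^ 2 * (‖t.1‖ ^ 2 + d * σx ^ 2) + σy ^ 2) := by
  have hcond (x : Vec d) :
      ∫⁻ y, ENNReal.ofReal (y ^ 2) ∂(gaussianReal (inner ℝ t.2 x) (σy ^ 2).toNNReal) ≤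
        ENNReal.ofReal (‖t.2‖ ^ 2 * ‖x‖ ^ 2 + σy ^ 2) := by
    have h := lintegral_ofReal_sub_sq_gaussianReal 0 (inner ℝ t.2 x) (σy ^ 2).toNNReal
    simp only [zero_sub, neg_sq, Real.coe_toNNReal _ (sq_nonneg σy)] at h
    rw [h, ← mul_pow, ← sq_abs (inner ℝ t.2 x)]
    gcongr
    exact abs_real_inner_le_norm _ _
  have hnorm := integrable_norm_pow_isoGaussian t.1 σx 2
  have hbound : Integrable (fun x : Vec d => ‖t.2‖ ^ 2 * ‖x‖ ^ 2 + σy ^ 2) (isoGaussian t.1 σx) :=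
    (hnorm.const_mul _).add (integrable_const _)
  rw [lintegral_taskLaw _ _ _ (by fun_prop)]
  refine (lintegral_mono hcond).trans (le_of_eq ?_)
  rw [← ofReal_integral_eq_lintegral_ofReal hbound (ae_of_all _ fun x => by positivity),
    integral_add (hnorm.const_mul _) (integrable_const _), integral_const_mul,
    integral_norm_sq_isoGaussian]
  simp

lemma pretrainRisk_zero_lt_top [IsFiniteMeasure prior]
    (hmoment : Integrable (fun t => ‖t.2‖ ^ 2 * (‖t.1‖ ^ 2 + d * σx ^ 2)) prior) (K : ℕ) :
    pretrainRisk prior σx σy K (fun _ _ _ => 0) < ∞ := by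
  have hlabel (t : Vec d × Vec d) (i : Fin K) :
      ∫⁻ S : Fin K → Vec d × ℝ, ENNReal.ofReal ((S i).2 ^ 2)
          ∂(Measure.pi fun _ => taskLaw σx σy t) ≤
        ENNReal.ofReal (‖t.2‖ ^ 2 * (‖t.1‖ ^ 2 + d * σx ^ 2) + σy ^ 2) :=
    ((measurePreserving_eval (fun _ : Fin K => taskLaw σx σy t) i).lintegral_comp
      (f := fun z => ENNReal.ofReal (z.2 ^ 2)) (by fun_prop)).trans_le (lintegral_label_sq_le _ _ t)
  have hrisk (t : Vec d × Vec d) : ∫⁻ S : Fin K → Vec d × ℝ,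
      ENNReal.ofReal ((1 / (K : ℝ)) * ∑ k : Fin K, (0 - (S k).2) ^ 2)
      ∂(Measure.pi fun _ => taskLaw σx σy t) ≤ ENNReal.ofReal (1 / (K : ℝ)) * (K *
        ENNReal.ofReal (‖t.2‖ ^ 2 * (‖t.1‖ ^ 2 + d * σx ^ 2) + σy ^ 2)) := by
    simp_rw [ENNReal.ofReal_mul (show 0 ≤ 1 / (K : ℝ) by positivity)]
    rw [lintegral_const_mul _ (by fun_prop)]
    gcongr
    simp_rw [ENNReal.ofReal_sum_of_nonneg fun _ _ => sq_nonneg _, zero_sub, neg_sq]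
    rw [lintegral_finsetSum _ fun _ _ => by fun_prop]
    simpa using Finset.sum_le_card_nsmul Finset.univ _ _ fun i _ => hlabel t i
  refine (lintegral_mono hrisk).trans_lt ?_
  rw [lintegral_const_mul' _ _ (by simp), lintegral_const_mul' _ _ (by simp)]
  exact ENNReal.mul_lt_top (by simp) (ENNReal.mul_lt_top (by simp)
    (hmoment.add (integrable_const (σy ^ 2))).lintegral_lt_top)

lemma IsOptimalPredictor.pretrainRisk_lt_top [IsFiniteMeasure prior]
    (hmoment : Integrable (fun t => ‖t.2‖ ^ 2 * (‖t.1‖ ^ 2 + d * σx ^ 2)) prior)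
    {F : Predictor d} (hF : IsOptimalPredictor prior σx σy F) {K : ℕ} (hK : 0 < K) :
    pretrainRisk prior σx σy K F < ∞ :=
  (hF.optimal K hK (fun _ _ _ => 0) fun _ => measurable_const).trans_lt
    (pretrainRisk_zero_lt_top hmoment K)

lemma IsOptimalPredictor.stageRisk_lt_top [IsFiniteMeasure prior] (hσx : 0 < σx) (hσy : 0 < σy)
    (hmoment : Integrable (fun t => ‖t.2‖ ^ 2 * (‖t.1‖ ^ 2 + d * σx ^ 2)) prior)
    {F : Predictor d} (hF : IsOptimalPredictor prior σx σy F) (k : ℕ) :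
    stageRisk prior σx σy (fun q : (Fin k → Vec d × ℝ) × Vec d => F k q.1 q.2) < ∞ := by
  have hfinite := hF.pretrainRisk_lt_top hmoment k.succ_pos
  rw [pretrainRisk_succ hσx hσy k (hF.continuous k).measurable] at hfinite
  refine ENNReal.lt_top_of_mul_ne_top_right (le_add_self.trans_lt hfinite).ne ?_
  exact (ENNReal.ofReal_pos.2 (by positivity)).ne'

lemma IsOptimalPredictor.stageRisk_le [IsFiniteMeasure prior] (hσx : 0 < σx) (hσy : 0 < σy)
    (hmoment : Integrable (fun t => ‖t.2‖ ^ 2 * (‖t.1‖ ^ 2 + d * σx ^ 2)) prior)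
    {F : Predictor d} (hF : IsOptimalPredictor prior σx σy F) {k : ℕ}
    {g : (Fin k → Vec d × ℝ) × Vec d → ℝ} (hg : Measurable g) :
    stageRisk prior σx σy (fun q : (Fin k → Vec d × ℝ) × Vec d => F k q.1 q.2) ≤
      stageRisk prior σx σy g := by
  have hF_meas (j : ℕ) : Measurable fun q : (Fin j → Vec d × ℝ) × Vec d => F j q.1 q.2 :=
    (hF.continuous j).measurable
  let G : Predictor d := Function.update F k fun S x => g (S, x)
  have hG_self : G k = fun S x => g (S, x) := Function.update_self _ _ _
  have hG_ne {j : ℕ} (hj : j ≠ k) : G j = F j := Function.update_of_ne hj _ _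
  have hG_meas (j : ℕ) : Measurable fun q : (Fin j → Vec d × ℝ) × Vec d => G j q.1 q.2 := by
    rcases eq_or_ne j k with rfl | hj
    · rwa [hG_self]
    · rw [hG_ne hj]; exact hF_meas j
  have hG_fin (j : Fin k) : G j = F j := hG_ne j.isLt.ne
  have hle := hF.optimal (k + 1) k.succ_pos G hG_meas
  have hfinite := hF.pretrainRisk_lt_top hmoment k.succ_pos
  rw [pretrainRisk_succ hσx hσy k (hF_meas k)] at hle hfinite
  rw [pretrainRisk_succ hσx hσy k (hG_meas k), hG_self] at hle
  simp_rw [hG_fin] at hle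
  have hlast := (ENNReal.add_le_add_iff_left (le_self_add.trans_lt hfinite).ne).1 hle
  refine (ENNReal.mul_le_mul_iff_right ?_ ENNReal.ofReal_ne_top).1 hlast
  exact (ENNReal.ofReal_pos.2 (by positivity)).ne'

lemma IsOptimalPredictor.lintegral_evidence_mul_sub_sq [IsProbabilityMeasure prior] (hσx : 0 < σx)
    (hσy : 0 < σy) (hw : MemLp (fun t => t.2) 2 prior)
    (hmoment : Integrable (fun t => ‖t.2‖ ^ 2 * (‖t.1‖ ^ 2 + d * σx ^ 2)) prior)
    {F : Predictor d} (hF : IsOptimalPredictor prior σx σy F) (k : ℕ) :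
    ∫⁻ q : (Fin k → Vec d × ℝ) × Vec d, ENNReal.ofReal
      (evidence prior σx σy q * (F k q.1 q.2 - bayesPredictor prior σx σy q) ^ 2) = 0 := by
  have hle := hF.stageRisk_le (k := k) hσx hσy hmoment
    (continuous_bayesPredictor hσx hσy (hw.integrable one_le_two)).measurable
  have hsplit := stageRisk_eq_add hσx hσy hw (hF.continuous k).measurable
  have hfinite := (hF.stageRisk_lt_top hσx hσy hmoment k).ne
  rw [hsplit] at hle hfinite
  by_contra hne
  exact hle.not_gt (add_comm _ (stageRisk prior σx σy _) ▸
    ENNReal.lt_add_right (ne_top_of_le_ne_top hfinite le_add_self) hne)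

instance isOpenPosMeasure_volume_sample : (volume : Measure (Vec d × ℝ)).IsOpenPosMeasure :=
  inferInstanceAs ((volume : Measure (Vec d)).prod volume).IsOpenPosMeasure

theorem IsOptimalPredictor.eq_bayesPredictor [IsProbabilityMeasure prior] (hσx : 0 < σx)
    (hσy : 0 < σy) (hw : MemLp (fun t => t.2) 2 prior)
    (hmoment : Integrable (fun t => ‖t.2‖ ^ 2 * (‖t.1‖ ^ 2 + d * σx ^ 2)) prior)
    {F : Predictor d} (hF : IsOptimalPredictor prior σx σy F) {k : ℕ}
    (S : Fin k → Vec d × ℝ) (x : Vec d) :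
    F k S x = bayesPredictor prior σx σy (S, x) := by
  have hF_cont := hF.continuous k
  have hbayes := continuous_bayesPredictor (prior := prior) (k := k) hσx hσy
    (hw.integrable one_le_two)
  have hevidence := continuous_evidence (prior := prior) (k := k) hσx hσy
  have hzero := hF.lintegral_evidence_mul_sub_sq hσx hσy hw hmoment k
  rw [lintegral_eq_zero_iff (by fun_prop)] at hzero
  have hae : (fun q : (Fin k → Vec d × ℝ) × Vec d => F k q.1 q.2) =ᵐ[volume]
      fun q => bayesPredictor prior σx σy q := by
    filter_upwards [hzero] with q hq
    have hsq := nonpos_of_mul_nonpos_right (ENNReal.ofReal_eq_zero.1 hq)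
      (evidence_pos (prior := prior) hσx hσy q)
    exact sub_eq_zero.1 (sq_nonpos_iff _ |>.1 hsq)
  exact congrFun ((Continuous.ae_eq_iff_eq volume hF_cont hbayes).1 hae) (S, x)

end Optimality

section RidgeRegression

variable {ι E : Type*} [Fintype ι] [NormedAddCommGroup E] [InnerProductSpace ℝ E]

/-- `u` solves the normal equation `(I + δ ∑ᵢ xᵢ xᵢᵀ) u = e` of ridge regression. For
`e = wₘ - w*` and `δ = σw² / σy²`, the vector `w* + u` is the posterior mean of the regression
vector under the prior `N(wₘ, σw² I)` after observing the inputs `xᵢ` with labels `⟨xᵢ, w*⟩`. -/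
def IsRidgeSolution (δ : ℝ) (x : ι → E) (e u : E) : Prop :=
  u + δ • ∑ i, inner ℝ (x i) u • x i = e

namespace IsRidgeSolution

variable {δ a b : ℝ} {x : ι → E} {e u e' u' : E}

lemma inner_left (hu : IsRidgeSolution δ x e u) (v : E) :
    inner ℝ e v = inner ℝ u v + δ * ∑ i, inner ℝ (x i) u * inner ℝ (x i) v := by
  rw [← hu, inner_add_left, real_inner_smul_left, sum_inner]
  simp_rw [real_inner_smul_left]

lemma inner_self (hu : IsRidgeSolution δ x e u) :
    inner ℝ u e = ‖u‖ ^ 2 + δ * ∑ i, inner ℝ (x i) u ^ 2 := by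
  rw [real_inner_comm, hu.inner_left, real_inner_self_eq_norm_sq]
  simp_rw [sq]

lemma norm_sq_add_norm_sub_sq_le (hδ : 0 ≤ δ) (hu : IsRidgeSolution δ x e u) :
    ‖u‖ ^ 2 + ‖u - e‖ ^ 2 ≤ ‖e‖ ^ 2 := by
  have hinner := hu.inner_self
  have hnonneg : 0 ≤ δ * ∑ i, inner ℝ (x i) u ^ 2 := by positivity
  rw [norm_sub_sq_real]
  linarith

lemma norm_le (hδ : 0 ≤ δ) (hu : IsRidgeSolution δ x e u) : ‖u‖ ≤ ‖e‖ :=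
  le_of_sq_le_sq (by linarith [hu.norm_sq_add_norm_sub_sq_le hδ, sq_nonneg ‖u - e‖])
    (norm_nonneg e)

lemma norm_sub_le (hδ : 0 ≤ δ) (hu : IsRidgeSolution δ x e u) : ‖u - e‖ ≤ ‖e‖ :=
  le_of_sq_le_sq (by linarith [hu.norm_sq_add_norm_sub_sq_le hδ, sq_nonneg ‖u‖]) (norm_nonneg e)

lemma mul_norm_le (hδ : 0 ≤ δ) (hu : IsRidgeSolution δ x e u)
    (ha : ∀ v, a * ‖v‖ ^ 2 ≤ ∑ i, inner ℝ (x i) v ^ 2) : (1 + δ * a) * ‖u‖ ≤ ‖e‖ := by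
  rcases (norm_nonneg u).eq_or_lt with hzero | hpos
  · simp [← hzero]
  · refine le_of_mul_le_mul_right ?_ hpos
    calc (1 + δ * a) * ‖u‖ * ‖u‖ = ‖u‖ ^ 2 + δ * (a * ‖u‖ ^ 2) := by ring
      _ ≤ ‖u‖ ^ 2 + δ * ∑ i, inner ℝ (x i) u ^ 2 := by gcongr; exact ha u
      _ = inner ℝ e u := by rw [real_inner_comm, hu.inner_self]
      _ ≤ ‖e‖ * ‖u‖ := real_inner_le_norm e u

-- `e - u` is the shrinkage `δ ∑ᵢ ⟨xᵢ, u⟩ xᵢ`; pair it with itself and use Cauchy-Schwarz.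
lemma norm_sub_le_mul (hδ : 0 ≤ δ) (hu : IsRidgeSolution δ x e u) (hb0 : 0 ≤ b)
    (hb : ∀ v, ∑ i, inner ℝ (x i) v ^ 2 ≤ b * ‖v‖ ^ 2) : ‖u - e‖ ≤ δ * b * ‖e‖ := by
  have hself : ‖e - u‖ ^ 2 = δ * ∑ i, inner ℝ (x i) u * inner ℝ (x i) (e - u) := by
    rw [← real_inner_self_eq_norm_sq, inner_sub_left, hu.inner_left]
    ring
  have hcauchy : ∑ i, inner ℝ (x i) u * inner ℝ (x i) (e - u) ≤ b * ‖u‖ * ‖e - u‖ := by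
    refine le_of_sq_le_sq ((Finset.sum_mul_sq_le_sq_mul_sq _ _ _).trans ?_) (by positivity)
    calc (∑ i, inner ℝ (x i) u ^ 2) * ∑ i, inner ℝ (x i) (e - u) ^ 2
        ≤ (b * ‖u‖ ^ 2) * (b * ‖e - u‖ ^ 2) :=
          mul_le_mul (hb u) (hb _) (by positivity) (by positivity)
      _ = (b * ‖u‖ * ‖e - u‖) ^ 2 := by ring
  rw [norm_sub_rev]
  rcases (norm_nonneg (e - u)).eq_or_lt with hzero | hpos
  · rw [← hzero]; positivity
  · refine le_of_mul_le_mul_right ?_ hpos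
    calc ‖e - u‖ * ‖e - u‖ ≤ δ * (b * ‖u‖ * ‖e - u‖) := by rw [← sq, hself]; gcongr
      _ ≤ δ * (b * ‖e‖ * ‖e - u‖) := by gcongr; exact hu.norm_le hδ
      _ = δ * b * ‖e‖ * ‖e - u‖ := by ring

lemma mul_inner_le_norm_sq (hδ : 0 ≤ δ) (hu : IsRidgeSolution δ x e u) (ha0 : 0 ≤ a)
    (ha : ∀ v, a * ‖v‖ ^ 2 ≤ ∑ i, inner ℝ (x i) v ^ 2) :
    (1 + δ * a) * inner ℝ u e ≤ ‖e‖ ^ 2 :=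
  calc (1 + δ * a) * inner ℝ u e ≤ (1 + δ * a) * (‖u‖ * ‖e‖) := by
        gcongr; exact real_inner_le_norm u e
    _ = (1 + δ * a) * ‖u‖ * ‖e‖ := by ring
    _ ≤ ‖e‖ * ‖e‖ := by gcongr; exact hu.mul_norm_le hδ ha
    _ = ‖e‖ ^ 2 := (sq _).symm

-- With `A = I + δ ∑ᵢ xᵢ xᵢᵀ` and `A ≤ c I`, this is `0 ≤ ⟨A (c u - e), c u - e⟩` for `A u = e`.
lemma norm_sq_le_mul_inner (hδ : 0 ≤ δ) (hu : IsRidgeSolution δ x e u) (hb0 : 0 ≤ b)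
    (hb : ∀ v, ∑ i, inner ℝ (x i) v ^ 2 ≤ b * ‖v‖ ^ 2) :
    ‖e‖ ^ 2 ≤ (1 + δ * b) * inner ℝ u e := by
  obtain ⟨c, hc⟩ : ∃ c, c = 1 + δ * b := ⟨_, rfl⟩
  have hc_pos : 0 < c := by rw [hc]; positivity
  have hself := hu.inner_self
  have hcross := hu.inner_left e
  rw [real_inner_self_eq_norm_sq] at hcross
  have hupper := mul_le_mul_of_nonneg_left (hb e) hδ
  have hform : ∑ i, inner ℝ (x i) (c • u - e) ^ 2 = c ^ 2 * ∑ i, inner ℝ (x i) u ^ 2 -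
      2 * c * ∑ i, inner ℝ (x i) u * inner ℝ (x i) e + ∑ i, inner ℝ (x i) e ^ 2 := by
    simp_rw [inner_sub_right, real_inner_smul_right]
    rw [Finset.mul_sum, Finset.mul_sum, ← Finset.sum_sub_distrib, ← Finset.sum_add_distrib]
    exact Finset.sum_congr rfl fun i _ => by ring
  have hnonneg : 0 ≤ ‖c • u - e‖ ^ 2 + δ * ∑ i, inner ℝ (x i) (c • u - e) ^ 2 := by positivity
  rw [hform, norm_sub_sq_real, norm_smul, real_inner_smul_left, Real.norm_of_nonneg hc_pos.le]
    at hnonneg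
  rw [← hc]
  refine le_of_mul_le_mul_left ?_ hc_pos
  calc c * ‖e‖ ^ 2 = ‖e‖ ^ 2 + δ * (b * ‖e‖ ^ 2) := by rw [hc]; ring
    _ ≤ c * (c * inner ℝ u e) := by
      linear_combination hnonneg + hupper + (-c ^ 2) * hself + 2 * c * hcross -
        2 * ‖e‖ ^ 2 * hc

lemma residual_le (hδ : 0 ≤ δ) (hu : IsRidgeSolution δ x e u) (hu' : IsRidgeSolution δ x e' u')
    (ha0 : 0 ≤ a) (hab : a ≤ b) (ha : ∀ v, a * ‖v‖ ^ 2 ≤ ∑ i, inner ℝ (x i) v ^ 2)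
    (hb : ∀ v, ∑ i, inner ℝ (x i) v ^ 2 ≤ b * ‖v‖ ^ 2) (hle : b * ‖e‖ ^ 2 ≤ a * ‖e'‖ ^ 2) :
    ‖e‖ ^ 2 - inner ℝ u e ≤ ‖e'‖ ^ 2 - inner ℝ u' e' := by
  have hb0 : 0 ≤ b := ha0.trans hab
  have hlower := hu.norm_sq_le_mul_inner hδ hb0 hb
  have hupper := hu'.mul_inner_le_norm_sq hδ ha0 ha
  calc ‖e‖ ^ 2 - inner ℝ u e ≤ δ * (b * ‖e‖ ^ 2) / (1 + δ * b) := by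
        rw [le_div_iff₀ (by positivity)]; linarith
    _ ≤ δ * (a * ‖e'‖ ^ 2) / (1 + δ * a) := by gcongr
    _ ≤ ‖e'‖ ^ 2 - inner ℝ u' e' := by rw [div_le_iff₀ (by positivity)]; linarith

end IsRidgeSolution

lemma exists_isRidgeSolution [FiniteDimensional ℝ E] {δ : ℝ} (hδ : 0 ≤ δ) (x : ι → E) (e : E) :
    ∃ u, IsRidgeSolution δ x e u := by
  let A : E →ₗ[ℝ] E := LinearMap.id + δ • ∑ i, (innerₛₗ ℝ (x i)).smulRight (x i)
  have hA (u : E) : IsRidgeSolution δ x (A u) u := by simp [A, IsRidgeSolution]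
  have hinj : Function.Injective A := by
    refine (injective_iff_map_eq_zero A).2 fun u hu => norm_le_zero_iff.1 ?_
    simpa [hu] using (hA u).norm_le hδ
  obtain ⟨u, rfl⟩ := LinearMap.injective_iff_surjective.1 hinj e
  exact ⟨u, hA u⟩

end RidgeRegression

section GibbsWeights

variable {ι : Type*} [Fintype ι] {p H : ι → ℝ}

/-- The weight of the component `i` in the Gibbs distribution with prior weights `p` and energies
`H`. -/
def gibbsWeight (p H : ι → ℝ) (i : ι) : ℝ :=
  p i * Real.exp (-H i) / ∑ j, p j * Real.exp (-H j)

lemma sum_mul_exp_neg_pos (hp : ∀ i, 0 < p i) (hsum : ∑ i, p i = 1) (H : ι → ℝ) :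
    0 < ∑ i, p i * Real.exp (-H i) := by
  obtain ⟨i, hi, -⟩ := Finset.exists_ne_zero_of_sum_ne_zero (hsum.trans_ne one_ne_zero)
  exact Finset.sum_pos (fun j _ => mul_pos (hp j) (Real.exp_pos _)) ⟨i, hi⟩

lemma gibbsWeight_nonneg (hp : ∀ i, 0 < p i) (H : ι → ℝ) (i : ι) : 0 ≤ gibbsWeight p H i :=
  div_nonneg (mul_pos (hp i) (Real.exp_pos _)).le
    (Finset.sum_nonneg fun j _ => (mul_pos (hp j) (Real.exp_pos _)).le)

lemma sum_gibbsWeight (hp : ∀ i, 0 < p i) (hsum : ∑ i, p i = 1) (H : ι → ℝ) :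
    ∑ i, gibbsWeight p H i = 1 := by
  simp_rw [gibbsWeight]
  rw [← Finset.sum_div, div_self (sum_mul_exp_neg_pos hp hsum H).ne']

lemma sum_mul_exp_neg_smul_add {E : Type*} [AddCommGroup E] [Module ℝ E] (hp : ∀ i, 0 < p i)
    (hsum : ∑ i, p i = 1) (H : ι → ℝ) (a : E) (u : ι → E) :
    ∑ i, (p i * Real.exp (-H i)) • (a + u i) =
      (∑ i, p i * Real.exp (-H i)) • (a + ∑ i, gibbsWeight p H i • u i) := by
  have hT := (sum_mul_exp_neg_pos hp hsum H).ne'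
  have hterm (i : ι) : (∑ j, p j * Real.exp (-H j)) * gibbsWeight p H i = p i * Real.exp (-H i) :=
    mul_div_cancel₀ _ hT
  simp_rw [smul_add, Finset.smul_sum, smul_smul, hterm]
  rw [Finset.sum_add_distrib, ← Finset.sum_smul]

lemma gibbsWeight_le (hp : ∀ i, 0 < p i) (hsum : ∑ i, p i = 1) {α β : ι} {c : ℝ}
    (hc : c ≤ H β - H α) : gibbsWeight p H β ≤ (p α)⁻¹ * Real.exp (-c) := by
  have hpβ : p β ≤ 1 := hsum ▸ Finset.single_le_sum (fun i _ => (hp i).le) (Finset.mem_univ β)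
  have hα : p α * Real.exp (-H α) ≤ ∑ j, p j * Real.exp (-H j) :=
    Finset.single_le_sum (f := fun j => p j * Real.exp (-H j))
      (fun j _ => (mul_pos (hp j) (Real.exp_pos _)).le) (Finset.mem_univ α)
  have hpα := hp α
  calc gibbsWeight p H β ≤ 1 * Real.exp (-H β) / (p α * Real.exp (-H α)) := by
        unfold gibbsWeight; gcongr
    _ = (p α)⁻¹ * Real.exp (-(H β - H α)) := by
        rw [neg_sub, sub_eq_add_neg, Real.exp_add, Real.exp_neg (H α)]
        field_simp
    _ ≤ (p α)⁻¹ * Real.exp (-c) := by gcongr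

lemma norm_sum_smul_sq_le {E : Type*} [SeminormedAddCommGroup E] [NormedSpace ℝ E] {q : ι → ℝ}
    (hq : ∀ i, 0 ≤ q i) (hq_sum : ∑ i, q i = 1) (v : ι → E) :
    ‖∑ i, q i • v i‖ ^ 2 ≤ ∑ i, q i * ‖v i‖ ^ 2 := by
  have htriangle : ‖∑ i, q i • v i‖ ≤ ∑ i, q i * ‖v i‖ :=
    norm_sum_le_of_le _ fun i _ => by rw [norm_smul, Real.norm_of_nonneg (hq i)]
  refine (pow_le_pow_left₀ (norm_nonneg _) htriangle 2).trans ?_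
  simpa only [smul_eq_mul] using (even_two.convexOn_pow (𝕜 := ℝ)).map_sum_le (t := Finset.univ)
    (w := q) (p := fun i => ‖v i‖) (fun i _ => hq i) hq_sum fun i _ => Set.mem_univ _

lemma norm_sum_smul_le {E : Type*} [SeminormedAddCommGroup E] [NormedSpace ℝ E] {q : ι → ℝ}
    (hq : ∀ i, 0 ≤ q i) (hq_sum : ∑ i, q i = 1) {v : ι → E} {R : ℝ} (hv : ∀ i, ‖v i‖ ≤ R) :
    ‖∑ i, q i • v i‖ ≤ R :=
  calc ‖∑ i, q i • v i‖ ≤ ∑ i, q i * R := norm_sum_le_of_le _ fun i _ => by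
        rw [norm_smul, Real.norm_of_nonneg (hq i)]
        exact mul_le_mul_of_nonneg_left (hv i) (hq i)
    _ = R := by rw [← Finset.sum_mul, hq_sum, one_mul]

end GibbsWeights

section GaussianTilting

variable {d : ℕ} {s : ℝ}

lemma integral_isoGaussian (hs : 0 < s) {E : Type*} [NormedAddCommGroup E] [NormedSpace ℝ E]
    (m : Vec d) (h : Vec d → E) :
    ∫ x, h x ∂(isoGaussian m s) = ∫ x, isoDensity m s x • h x := by
  rw [isoGaussian_eq_withDensity m hs,
    integral_withDensity_eq_integral_toReal_smul (by fun_prop) (by simp)]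
  simp_rw [ENNReal.toReal_ofReal (isoDensity_pos hs m _).le]

lemma integral_exp_neg_smul_isoGaussian (hs : 0 < s) {E : Type*} [NormedAddCommGroup E]
    [NormedSpace ℝ E] {φ ψ : Vec d → ℝ} {m c : Vec d} {r : ℝ}
    (hsquare : ∀ w, ‖w - m‖ ^ 2 / (2 * s ^ 2) + φ w =
      ‖w - c‖ ^ 2 / (2 * s ^ 2) + ψ (w - c) + r) (h : Vec d → E) :
    ∫ w, Real.exp (-φ w) • h w ∂(isoGaussian m s) =
      Real.exp (-r) • ∫ v, Real.exp (-ψ v) • h (v + c) ∂(isoGaussian 0 s) := by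
  rw [integral_isoGaussian hs, integral_isoGaussian hs, ← integral_smul,
    ← integral_add_right_eq_self _ c]
  refine integral_congr_ae (ae_of_all _ fun v => ?_)
  have hexponent : -(1 / (2 * s ^ 2)) * ‖v + c - m‖ ^ 2 + -φ (v + c) =
      -r + (-(1 / (2 * s ^ 2)) * ‖v - 0‖ ^ 2 + -ψ v) := by
    have hv := hsquare (v + c)
    rw [add_sub_cancel_right] at hv
    rw [sub_zero]
    linear_combination -hv
  simp only [smul_smul, isoDensity]
  rw [mul_assoc, ← Real.exp_add, hexponent, Real.exp_add, Real.exp_add]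
  congr 1
  ring

lemma integral_exp_neg_isoGaussian (hs : 0 < s) {φ ψ : Vec d → ℝ} {m c : Vec d} {r : ℝ}
    (hsquare : ∀ w, ‖w - m‖ ^ 2 / (2 * s ^ 2) + φ w =
      ‖w - c‖ ^ 2 / (2 * s ^ 2) + ψ (w - c) + r) :
    ∫ w, Real.exp (-φ w) ∂(isoGaussian m s) =
      (∫ v, Real.exp (-ψ v) ∂(isoGaussian 0 s)) * Real.exp (-r) := by
  simpa [mul_comm] using integral_exp_neg_smul_isoGaussian hs hsquare (fun _ => (1 : ℝ))

variable {ψ : Vec d → ℝ}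

lemma integrable_exp_neg_smul_isoGaussian (hψ : Continuous ψ) (hψ_nonneg : ∀ v, 0 ≤ ψ v)
    {E : Type*} [NormedAddCommGroup E] [NormedSpace ℝ E] {m : Vec d} {h : Vec d → E}
    (hh : Integrable h (isoGaussian m s)) :
    Integrable (fun v => Real.exp (-ψ v) • h v) (isoGaussian m s) := by
  refine hh.bdd_smul 1 (Continuous.aestronglyMeasurable (by fun_prop)) (ae_of_all _ fun v => ?_)
  rw [Real.norm_eq_abs, Real.abs_exp, Real.exp_le_one_iff]
  exact neg_nonpos.2 (hψ_nonneg v)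

lemma integral_exp_neg_isoGaussian_pos (hψ : Continuous ψ) (hψ_nonneg : ∀ v, 0 ≤ ψ v)
    (m : Vec d) : 0 < ∫ v, Real.exp (-ψ v) ∂(isoGaussian m s) :=
  integral_exp_pos
    (by simpa using integrable_exp_neg_smul_isoGaussian hψ hψ_nonneg (integrable_const (1 : ℝ)))

lemma integral_exp_neg_smul_id_of_even (hs : 0 < s) (heven : ∀ v, ψ (-v) = ψ v) :
    ∫ v, Real.exp (-ψ v) • v ∂(isoGaussian 0 s) = 0 := by
  have : IsAddTorsionFree (Vec d) := .of_isTorsionFree ℝ (Vec d)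
  rw [integral_isoGaussian hs]
  refine self_eq_neg.1 ((integral_neg_eq_self _ volume).symm.trans ?_)
  rw [← integral_neg]
  simp only [isoDensity, heven, sub_zero, norm_neg, smul_neg]

lemma integral_exp_neg_smul_id_isoGaussian (hs : 0 < s) (hψ : Continuous ψ)
    (hψ_nonneg : ∀ v, 0 ≤ ψ v) (heven : ∀ v, ψ (-v) = ψ v) {φ : Vec d → ℝ} {m c : Vec d} {r : ℝ}
    (hsquare : ∀ w, ‖w - m‖ ^ 2 / (2 * s ^ 2) + φ w =
      ‖w - c‖ ^ 2 / (2 * s ^ 2) + ψ (w - c) + r) :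
    ∫ w, Real.exp (-φ w) • w ∂(isoGaussian m s) =
      ((∫ v, Real.exp (-ψ v) ∂(isoGaussian 0 s)) * Real.exp (-r)) • c := by
  have hid : Integrable (fun v => Real.exp (-ψ v) • v) (isoGaussian 0 s) :=
    integrable_exp_neg_smul_isoGaussian hψ hψ_nonneg IsGaussian.integrable_fun_id
  have hconst : Integrable (fun v => Real.exp (-ψ v) • c) (isoGaussian 0 s) :=
    integrable_exp_neg_smul_isoGaussian hψ hψ_nonneg (integrable_const c)
  rw [integral_exp_neg_smul_isoGaussian hs hsquare]
  simp_rw [smul_add]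
  rw [integral_add hid hconst, integral_exp_neg_smul_id_of_even hs heven, zero_add,
    integral_smul_const, smul_smul, mul_comm]

end GaussianTilting

section CompletingTheSquare

variable {ι E : Type*} [Fintype ι] [NormedAddCommGroup E] [InnerProductSpace ℝ E]

/-- The part that depends on the component of the negative log-likelihood of the inputs `x`, where
the input mean has the prior `N(μm, σμ² I)`. It is measured relative to the reference mean `μs`,
which makes it centered for `xᵢ ∼ N(μs, τ² I)` up to the term in `‖μm - μs‖²`. -/
def meanEnergy (σμ σx : ℝ) (μs : E) (x : ι → E) (μm : E) : ℝ :=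
  (Fintype.card ι * ‖μm - μs‖ ^ 2 - 2 * inner ℝ (μm - μs) (∑ i, (x i - μs))) /
    (2 * σx ^ 2 * (1 + Fintype.card ι * (σμ ^ 2 / σx ^ 2)))

/-- The part that depends on the component of the negative log-likelihood of the noiseless labels
`⟨xᵢ, ws⟩`, where the regression vector has the prior `N(ws + e, σw² I)` and `u` is the ridge
solution for `e`. -/
def regressionEnergy (σw : ℝ) (e u : E) : ℝ :=
  (‖e‖ ^ 2 - inner ℝ u e) / (2 * σw ^ 2)

lemma sum_norm_sub_sq (x : ι → E) (a b : E) :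
    ∑ i, ‖x i - b‖ ^ 2 = ∑ i, ‖x i - a‖ ^ 2 - 2 * inner ℝ (∑ i, (x i - a)) (b - a) +
      Fintype.card ι * ‖b - a‖ ^ 2 := by
  have hterm (i : ι) :
      ‖x i - b‖ ^ 2 = ‖x i - a‖ ^ 2 - 2 * inner ℝ (x i - a) (b - a) + ‖b - a‖ ^ 2 := by
    rw [← sub_sub_sub_cancel_right (x i) b a, norm_sub_sq_real]
  simp_rw [hterm]
  rw [Finset.sum_add_distrib, Finset.sum_sub_distrib, ← Finset.mul_sum, ← sum_inner]
  simp

lemma exists_mean_square_completion {σμ σx : ℝ} (hσμ : 0 < σμ) (hσx : 0 < σx) (μs : E)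
    (x : ι → E) :
    ∃ r : ℝ, ∀ μm, ∃ c : E, ∀ μ,
      ‖μ - μm‖ ^ 2 / (2 * σμ ^ 2) + (∑ i, ‖x i - μ‖ ^ 2) / (2 * σx ^ 2) =
        ‖μ - c‖ ^ 2 / (2 * σμ ^ 2) + Fintype.card ι * ‖μ - c‖ ^ 2 / (2 * σx ^ 2) +
          (meanEnergy σμ σx μs x μm + r) := by
  obtain ⟨δ, hδ⟩ : ∃ δ, δ = σμ ^ 2 / σx ^ 2 := ⟨_, rfl⟩
  obtain ⟨s, hs⟩ : ∃ s, s = ∑ i, (x i - μs) := ⟨_, rfl⟩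
  obtain ⟨n, hn, hn_nonneg⟩ : ∃ n : ℝ, n = Fintype.card ι ∧ 0 ≤ n := ⟨_, rfl, by positivity⟩
  have hδ_pos : 0 < δ := by rw [hδ]; positivity
  have hσ : σμ ^ 2 = δ * σx ^ 2 := by rw [hδ]; field_simp
  have hprecision : 0 < 1 + n * δ := by positivity
  refine ⟨(∑ i, ‖x i - μs‖ ^ 2) / (2 * σx ^ 2) - δ * ‖s‖ ^ 2 / (2 * σx ^ 2 * (1 + n * δ)),
    fun μm => ⟨μs + (1 + n * δ)⁻¹ • (μm - μs + δ • s), fun μ => ?_⟩⟩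
  rw [sum_norm_sub_sq x μs, ← sub_sub_sub_cancel_right μ μm μs, ← sub_sub μ μs, meanEnergy, ← hn,
    ← hs, ← hδ, hσ]
  generalize μ - μs = v, μm - μs = a
  rw [norm_sub_sq_real v a, norm_sub_sq_real v, norm_smul, real_inner_smul_right,
    inner_add_right, real_inner_smul_right, mul_pow, norm_add_sq_real a, norm_smul,
    real_inner_smul_right, Real.norm_of_nonneg (inv_nonneg.2 hprecision.le),
    Real.norm_of_nonneg hδ_pos.le, real_inner_comm s v]
  field_simp
  ring

lemma IsRidgeSolution.regression_square_completion {σw σy : ℝ} (hσw : 0 < σw) (hσy : 0 < σy)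
    {x : ι → E} {e u : E} (hu : IsRidgeSolution (σw ^ 2 / σy ^ 2) x e u) (ws w : E) :
    ‖w - (ws + e)‖ ^ 2 / (2 * σw ^ 2) +
        (∑ i, (inner ℝ (x i) ws - inner ℝ w (x i)) ^ 2) / (2 * σy ^ 2) =
      ‖w - (ws + u)‖ ^ 2 / (2 * σw ^ 2) +
        (∑ i, inner ℝ (x i) (w - (ws + u)) ^ 2) / (2 * σy ^ 2) + regressionEnergy σw e u := by
  obtain ⟨y, rfl⟩ : ∃ y, w = y + (ws + u) := ⟨_, (sub_add_cancel _ _).symm⟩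
  have hshift : y + (ws + u) - (ws + e) = y + u - e := by abel
  have hlabel (i : ι) : (inner ℝ (x i) ws - inner ℝ (y + (ws + u)) (x i)) ^ 2 =
      inner ℝ (x i) y ^ 2 + 2 * (inner ℝ (x i) u * inner ℝ (x i) y) + inner ℝ (x i) u ^ 2 := by
    rw [real_inner_comm (x i) (y + (ws + u)), inner_add_right, inner_add_right]
    ring
  have hey := hu.inner_left y
  have hself := hu.inner_self
  rw [hshift, add_sub_cancel_right, regressionEnergy]
  simp_rw [hlabel]
  rw [Finset.sum_add_distrib, Finset.sum_add_distrib, ← Finset.mul_sum, norm_sub_sq_real (y + u) e,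
    norm_add_sq_real, inner_add_left, real_inner_comm e y]
  rw [real_inner_comm y u] at hey
  field_simp at hey hself ⊢
  linear_combination -hself - 2 * hey

end CompletingTheSquare

section TaskPrior

variable {d M : ℕ} {p : Fin M → ℝ} {μc wc : Fin M → Vec d} {σμ σw : ℝ}

lemma isProbabilityMeasure_taskPrior (hp : ∀ m, 0 < p m) (hsum : ∑ m, p m = 1) :
    IsProbabilityMeasure (taskPrior p μc wc σμ σw) := by
  refine ⟨?_⟩
  simp only [taskPrior, Measure.finsetSum_apply, Measure.smul_apply, measure_univ, smul_eq_mul,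
    mul_one]
  rw [← ENNReal.ofReal_sum_of_nonneg fun m _ => (hp m).le, hsum, ENNReal.ofReal_one]

lemma integrable_taskPrior {E : Type*} [NormedAddCommGroup E] {g : Vec d × Vec d → E}
    (hg : ∀ m, Integrable g ((isoGaussian (μc m) σμ).prod (isoGaussian (wc m) σw))) :
    Integrable g (taskPrior p μc wc σμ σw) :=
  integrable_finsetSum_measure.2 fun m _ => (hg m).smul_measure ENNReal.ofReal_ne_top

lemma integral_taskPrior {E : Type*} [NormedAddCommGroup E] [NormedSpace ℝ E] (hp : ∀ m, 0 ≤ p m)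
    {g : Vec d × Vec d → E}
    (hg : ∀ m, Integrable g ((isoGaussian (μc m) σμ).prod (isoGaussian (wc m) σw))) :
    ∫ t, g t ∂(taskPrior p μc wc σμ σw) =
      ∑ m, p m • ∫ t, g t ∂((isoGaussian (μc m) σμ).prod (isoGaussian (wc m) σw)) := by
  rw [taskPrior, integral_finsetSum_measure fun m _ =>
    (hg m).smul_measure ENNReal.ofReal_ne_top]
  exact Finset.sum_congr rfl fun m _ => by
    rw [integral_smul_measure, ENNReal.toReal_ofReal (hp m)]

lemma memLp_snd_taskPrior : MemLp (fun t => t.2) 2 (taskPrior p μc wc σμ σw) :=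
  (memLp_two_iff_integrable_sq_norm measurable_snd.aestronglyMeasurable).2
    (integrable_taskPrior fun m => (integrable_norm_pow_isoGaussian (wc m) σw 2).comp_snd _)

lemma integrable_moment_taskPrior (c : ℝ) :
    Integrable (fun t => ‖t.2‖ ^ 2 * (‖t.1‖ ^ 2 + c)) (taskPrior p μc wc σμ σw) := by
  refine integrable_taskPrior fun m => ?_
  have hfst : Integrable (fun x => ‖x‖ ^ 2 + c) (isoGaussian (μc m) σμ) :=
    (integrable_norm_pow_isoGaussian _ _ 2).add (integrable_const _)
  simpa only [mul_comm] using hfst.mul_prod (integrable_norm_pow_isoGaussian (wc m) σw 2)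

end TaskPrior

section ClosedForm

variable {d : ℕ}

lemma prod_isoDensity {ι : Type*} [Fintype ι] (m : Vec d) (s : ℝ) (x : ι → Vec d) :
    ∏ i, isoDensity m s (x i) = ((2 * Real.pi * s ^ 2) ^ (d / 2 : ℝ))⁻¹ ^ Fintype.card ι *
      Real.exp (-((∑ i, ‖x i - m‖ ^ 2) / (2 * s ^ 2))) := by
  simp only [isoDensity]
  rw [Finset.prod_mul_distrib, Finset.prod_const, Finset.card_univ, ← Real.exp_sum,
    ← Finset.mul_sum]
  ring_nf

lemma prod_gaussianPDFReal {ι : Type*} [Fintype ι] (v : NNReal) (m y : ι → ℝ) :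
    ∏ i, gaussianPDFReal (m i) v (y i) = (√(2 * Real.pi * v))⁻¹ ^ Fintype.card ι *
      Real.exp (-((∑ i, (y i - m i) ^ 2) / (2 * v))) := by
  simp only [gaussianPDFReal]
  rw [Finset.prod_mul_distrib, Finset.prod_const, Finset.card_univ, ← Real.exp_sum,
    ← Finset.sum_div, Finset.sum_neg_distrib, neg_div]

lemma exists_likelihood_eq_mul_exp {σx σy : ℝ} (hσx : 0 < σx) (hσy : 0 < σy) (ws : Vec d) {k : ℕ}
    (x : Fin (k + 1) → Vec d) :
    ∃ κ : ℝ, 0 < κ ∧ ∀ t : Vec d × Vec d,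
      likelihood σx σy t
          (fun i => (x (Fin.castSucc i), inner ℝ (x i.castSucc) ws), x (Fin.last k)) =
        κ * Real.exp (-((∑ i, ‖x i - t.1‖ ^ 2) / (2 * σx ^ 2))) *
          Real.exp (-((∑ i : Fin k, (inner ℝ (x i.castSucc) ws - inner ℝ t.2 (x i.castSucc)) ^ 2) /
            (2 * σy ^ 2))) := by
  refine ⟨((2 * Real.pi * σx ^ 2) ^ (d / 2 : ℝ))⁻¹ ^ (k + 1) * (√(2 * Real.pi * σy ^ 2))⁻¹ ^ k,
    by positivity, fun t => ?_⟩
  have hinputs := prod_isoDensity t.1 σx x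
  have hlabels := prod_gaussianPDFReal (σy ^ 2).toNNReal
    (fun i : Fin k => inner ℝ t.2 (x i.castSucc)) fun i => inner ℝ (x i.castSucc) ws
  rw [Fintype.card_fin, Fin.prod_univ_castSucc] at hinputs
  rw [Fintype.card_fin, Real.coe_toNNReal _ (sq_nonneg σy)] at hlabels
  simp only [likelihood, sampleDensity]
  rw [Finset.prod_mul_distrib, mul_right_comm, hinputs, hlabels]
  ring

/-- The negative log-likelihood of a noiselessly labeled prompt under the component with centers
`(μm, ws + e)`, up to a constant that does not depend on the component. The argument `u` is the
ridge solution for `e` and the prompt inputs; `x` contains the query as well, which carries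
information on the input mean. -/
def energy (σμ σw σx : ℝ) (μs : Vec d) {ι : Type*} [Fintype ι] (x : ι → Vec d)
    (μm e u : Vec d) : ℝ :=
  meanEnergy σμ σx μs x μm + regressionEnergy σw e u

variable {σμ σw σx σy : ℝ}

lemma exists_integral_inputs (hσμ : 0 < σμ) (hσx : 0 < σx) (μs : Vec d) {ι : Type*} [Fintype ι]
    (x : ι → Vec d) :
    ∃ Z : ℝ, 0 < Z ∧ ∀ μm : Vec d,
      ∫ μ, Real.exp (-((∑ i, ‖x i - μ‖ ^ 2) / (2 * σx ^ 2))) ∂(isoGaussian μm σμ) =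
        Z * Real.exp (-meanEnergy σμ σx μs x μm) := by
  obtain ⟨r, hmean⟩ := exists_mean_square_completion hσμ hσx μs x
  set ψ : Vec d → ℝ := fun v => Fintype.card ι * ‖v‖ ^ 2 / (2 * σx ^ 2)
  have hpos : 0 < ∫ v, Real.exp (-ψ v) ∂(isoGaussian 0 σμ) :=
    integral_exp_neg_isoGaussian_pos (by fun_prop) (fun v => by positivity) 0
  refine ⟨(∫ v, Real.exp (-ψ v) ∂(isoGaussian 0 σμ)) * Real.exp (-r), by positivity,
    fun μm => ?_⟩
  obtain ⟨c, hc⟩ := hmean μm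
  rw [integral_exp_neg_isoGaussian (ψ := ψ) hσμ hc, neg_add, Real.exp_add]
  ring

lemma exists_integral_labels (hσw : 0 < σw) (hσy : 0 < σy) (ws : Vec d) {ι : Type*} [Fintype ι]
    (x : ι → Vec d) :
    ∃ Z : ℝ, 0 < Z ∧ ∀ e u : Vec d, IsRidgeSolution (σw ^ 2 / σy ^ 2) x e u →
      ∫ w, Real.exp (-((∑ i, (inner ℝ (x i) ws - inner ℝ w (x i)) ^ 2) / (2 * σy ^ 2)))
          ∂(isoGaussian (ws + e) σw) = Z * Real.exp (-regressionEnergy σw e u) ∧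
      ∫ w, Real.exp (-((∑ i, (inner ℝ (x i) ws - inner ℝ w (x i)) ^ 2) / (2 * σy ^ 2))) • w
          ∂(isoGaussian (ws + e) σw) = (Z * Real.exp (-regressionEnergy σw e u)) • (ws + u) := by
  set ψ : Vec d → ℝ := fun v => (∑ i, inner ℝ (x i) v ^ 2) / (2 * σy ^ 2)
  have hψ : Continuous ψ := by fun_prop
  have hψ_nonneg (v : Vec d) : 0 ≤ ψ v := by positivity
  have hψ_even (v : Vec d) : ψ (-v) = ψ v := by simp only [ψ, inner_neg_right, neg_sq]
  refine ⟨∫ v, Real.exp (-ψ v) ∂(isoGaussian 0 σw),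
    integral_exp_neg_isoGaussian_pos hψ hψ_nonneg 0, fun e u hu => ?_⟩
  have hsquare := hu.regression_square_completion hσw hσy ws
  exact ⟨integral_exp_neg_isoGaussian (ψ := ψ) hσw hsquare,
    integral_exp_neg_smul_id_isoGaussian hσw hψ hψ_nonneg hψ_even hsquare⟩

lemma exists_integral_likelihood (hσμ : 0 < σμ) (hσw : 0 < σw) (hσx : 0 < σx) (hσy : 0 < σy)
    (μs ws : Vec d) {k : ℕ} (x : Fin (k + 1) → Vec d) :
    ∃ Z : ℝ, 0 < Z ∧ ∀ μm e u : Vec d,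
      IsRidgeSolution (σw ^ 2 / σy ^ 2) (fun i : Fin k => x i.castSucc) e u →
      ∫ t, likelihood σx σy t (fun i => (x (Fin.castSucc i), inner ℝ (x i.castSucc) ws),
          x (Fin.last k)) ∂((isoGaussian μm σμ).prod (isoGaussian (ws + e) σw)) =
        Z * Real.exp (-energy σμ σw σx μs x μm e u) ∧
      ∫ t, likelihood σx σy t (fun i => (x (Fin.castSucc i), inner ℝ (x i.castSucc) ws),
          x (Fin.last k)) • t.2 ∂((isoGaussian μm σμ).prod (isoGaussian (ws + e) σw)) =
        (Z * Real.exp (-energy σμ σw σx μs x μm e u)) • (ws + u) := by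
  obtain ⟨κ, hκ, hlikelihood⟩ := exists_likelihood_eq_mul_exp hσx hσy ws x
  obtain ⟨Zμ, hZμ, hinputs⟩ := exists_integral_inputs hσμ hσx μs x
  obtain ⟨Zw, hZw, hlabels⟩ := exists_integral_labels hσw hσy ws fun i : Fin k => x i.castSucc
  set A : Vec d → ℝ := fun μ => Real.exp (-((∑ i, ‖x i - μ‖ ^ 2) / (2 * σx ^ 2)))
  set G : Vec d → ℝ := fun w => Real.exp (-((∑ i : Fin k,
    (inner ℝ (x i.castSucc) ws - inner ℝ w (x i.castSucc)) ^ 2) / (2 * σy ^ 2)))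
  have hsplit (t : Vec d × Vec d) : likelihood σx σy t (fun i =>
      (x (Fin.castSucc i), inner ℝ (x i.castSucc) ws), x (Fin.last k)) = κ * (A t.1 * G t.2) :=
    (hlikelihood t).trans (mul_assoc _ _ _)
  refine ⟨κ * Zμ * Zw, by positivity, fun μm e u hu => ?_⟩
  obtain ⟨hlabels_one, hlabels_id⟩ := hlabels e u hu
  simp_rw [hsplit]
  rw [energy, neg_add, Real.exp_add]
  constructor
  · rw [integral_const_mul, integral_prod_mul A G, hinputs, hlabels_one]
    ring
  · simp_rw [mul_smul κ, mul_smul (A _)]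
    rw [integral_smul, integral_prod_smul A (fun w => G w • w), hinputs, hlabels_id, smul_smul,
      smul_smul]
    ring_nf

-- Every component posterior is Gaussian, and its weight is the Gibbs weight of its energy.
theorem IsOptimalPredictor.eq_inner {M : ℕ} {p : Fin M → ℝ} {μc wc : Fin M → Vec d}
    (hp : ∀ m, 0 < p m) (hsum : ∑ m, p m = 1) (hσμ : 0 < σμ) (hσw : 0 < σw) (hσx : 0 < σx)
    (hσy : 0 < σy) {F : Predictor d} (hF : IsOptimalPredictor (taskPrior p μc wc σμ σw) σx σy F)
    (μs ws : Vec d) {k : ℕ} (x : Fin (k + 1) → Vec d) {u : Fin M → Vec d}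
    (hu : ∀ m, IsRidgeSolution (σw ^ 2 / σy ^ 2) (fun i : Fin k => x i.castSucc) (wc m - ws)
      (u m)) :
    F k (fun i => (x i.castSucc, inner ℝ (x i.castSucc) ws)) (x (Fin.last k)) =
      inner ℝ (ws + ∑ m, gibbsWeight p
        (fun m => energy σμ σw σx μs x (μc m) (wc m - ws) (u m)) m • u m) (x (Fin.last k)) := by
  have := isProbabilityMeasure_taskPrior (μc := μc) (wc := wc) (σμ := σμ) (σw := σw) hp hsum
  set H : Fin M → ℝ := fun m => energy σμ σw σx μs x (μc m) (wc m - ws) (u m)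
  obtain ⟨Z, hZ, hcomponent⟩ := exists_integral_likelihood hσμ hσw hσx hσy μs ws x
  have hcomponent (m : Fin M) := hcomponent (μc m) (wc m - ws) (u m) (hu m)
  simp_rw [add_sub_cancel] at hcomponent
  set q : (Fin k → Vec d × ℝ) × Vec d :=
    (fun i => (x i.castSucc, inner ℝ (x i.castSucc) ws), x (Fin.last k))
  set T := ∑ m, p m * Real.exp (-H m) with hT
  have hT_pos : 0 < T := sum_mul_exp_neg_pos hp hsum H
  have hevidence : evidence (taskPrior p μc wc σμ σw) σx σy q = Z * T := by
    rw [evidence, integral_taskPrior (fun m => (hp m).le)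
      fun m => integrable_likelihood hσx hσy q, hT, Finset.mul_sum]
    exact Finset.sum_congr rfl fun m _ => by rw [(hcomponent m).1, smul_eq_mul, mul_left_comm]
  have hweighted : weightedTask (taskPrior p μc wc σμ σw) σx σy q =
      (Z * T) • (ws + ∑ m, gibbsWeight p H m • u m) := by
    rw [weightedTask, integral_taskPrior (fun m => (hp m).le) fun m =>
      integrable_likelihood_smul hσx hσy q (IsGaussian.integrable_fun_id.comp_snd _), mul_smul,
      ← sum_mul_exp_neg_smul_add hp hsum, Finset.smul_sum]
    exact Finset.sum_congr rfl fun m _ => by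
      rw [(hcomponent m).2, smul_smul, smul_smul, mul_left_comm]
  rw [hF.eq_bayesPredictor hσx hσy memLp_snd_taskPrior (integrable_moment_taskPrior _),
    bayesPredictor, hevidence, hweighted, real_inner_smul_left,
    mul_div_cancel_left₀ _ (by positivity)]

end ClosedForm

section Concentration

lemma real_inner_sq_le {E : Type*} [SeminormedAddCommGroup E] [InnerProductSpace ℝ E] (a b : E) :
    inner ℝ a b ^ 2 ≤ ‖a‖ ^ 2 * ‖b‖ ^ 2 := by
  rw [← sq_abs, ← mul_pow]
  exact pow_le_pow_left₀ (abs_nonneg _) (abs_real_inner_le_norm a b) 2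

lemma exists_pos_exp_mul_mgf_lt_one {Ω : Type*} [MeasurableSpace Ω] {ν : Measure Ω}
    [IsProbabilityMeasure ν] {f : Ω → ℝ} (h0 : 0 ∈ interior (integrableExpSet f ν)) {c : ℝ}
    (hc : ∫ z, f z ∂ν < c) :
    ∃ t : ℝ, 0 < t ∧ Integrable (fun z => Real.exp (t * f z)) ν ∧
      Real.exp (-t * c) * mgf f ν t < 1 := by
  have hderiv : HasDerivAt (fun t => Real.exp (-t * c) * mgf f ν t) (∫ z, f z ∂ν - c) 0 := by
    have hmgf : HasDerivAt (mgf f ν) (∫ z, f z ∂ν) 0 := by simpa using hasDerivAt_mgf h0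
    have hexp : HasDerivAt (fun t : ℝ => Real.exp (-t * c)) (-c) 0 := by
      simpa using ((hasDerivAt_id (0 : ℝ)).neg.mul_const c).exp
    refine (hexp.mul hmgf).congr_deriv ?_
    rw [mgf_zero, neg_zero, zero_mul, Real.exp_zero]
    ring
  have hlt : ∀ᶠ t in nhdsWithin (0 : ℝ) (Set.Ioi 0), Real.exp (-t * c) * mgf f ν t < 1 := by
    filter_upwards [hderiv.tendsto_slope_zero_right.eventually_lt_const (sub_neg.2 hc),
      self_mem_nhdsWithin] with t hslope (htpos : 0 < t)
    simp only [zero_add, smul_eq_mul, neg_zero, zero_mul, Real.exp_zero, mgf_zero, one_mul]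
      at hslope
    linarith [neg_of_mul_neg_right hslope (by positivity)]
  have hint : ∀ᶠ t in nhdsWithin (0 : ℝ) (Set.Ioi 0), t ∈ integrableExpSet f ν :=
    mem_nhdsWithin_of_mem_nhds (mem_interior_iff_mem_nhds.1 h0)
  obtain ⟨t, ⟨ht, htint⟩, htpos⟩ := ((hlt.and hint).and self_mem_nhdsWithin).exists
  exact ⟨t, htpos, htint, ht⟩

lemma mgf_eval_pi {Ω ι : Type*} [MeasurableSpace Ω] [Fintype ι] (ν : Measure Ω)
    [IsProbabilityMeasure ν] {f : Ω → ℝ} (hf : Measurable f) (i : ι) (t : ℝ) :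
    mgf (fun x : ι → Ω => f (x i)) (Measure.pi fun _ => ν) t = mgf f ν t := by
  have heval := measurePreserving_eval (fun _ : ι => ν) i
  have hmap := mgf_map (μ := Measure.pi fun _ : ι => ν) (X := f) (t := t)
    heval.measurable.aemeasurable (by fun_prop)
  rw [heval.map_eq] at hmap
  exact hmap.symm

lemma measureReal_pi_sum_ge_le_pow {Ω ι : Type*} [MeasurableSpace Ω] [Fintype ι] {ν : Measure Ω}
    [IsProbabilityMeasure ν] {f : Ω → ℝ} (hf : Measurable f) {t : ℝ} (ht : 0 ≤ t)
    (hint : Integrable (fun z => Real.exp (t * f z)) ν) (c : ℝ) (s : Finset ι) :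
    (Measure.pi fun _ : ι => ν).real {x | s.card * c ≤ ∑ i ∈ s, f (x i)} ≤
      (Real.exp (-t * c) * mgf f ν t) ^ s.card := by
  have hindep : iIndepFun (fun (i : ι) (x : ι → Ω) => f (x i)) (Measure.pi fun _ => ν) :=
    iIndepFun_pi (X := fun _ => f) fun _ => hf.aemeasurable
  have hmeas (i : ι) : Measurable fun x : ι → Ω => f (x i) := hf.comp (measurable_pi_apply i)
  have hmarkov := measure_ge_le_exp_mul_mgf (s.card * c) ht <|
    hindep.integrable_exp_mul_sum (s := s) hmeas fun i _ =>
      (measurePreserving_eval (fun _ : ι => ν) i).integrable_comp_of_integrable hint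
  rw [hindep.mgf_sum hmeas] at hmarkov
  simp only [mgf_eval_pi ν hf, Finset.prod_const, Finset.sum_apply] at hmarkov
  refine hmarkov.trans_eq ?_
  rw [mul_pow, ← Real.exp_nat_mul]
  congr 2
  ring

lemma exists_pow_bound_measureReal_pi_sum_ge {Ω : Type*} [MeasurableSpace Ω] {ν : Measure Ω}
    [IsProbabilityMeasure ν] {f : Ω → ℝ} (hf : Measurable f)
    (h0 : 0 ∈ interior (integrableExpSet f ν)) {c : ℝ} (hc : ∫ z, f z ∂ν < c) :
    ∃ ρ : ℝ, 0 < ρ ∧ ρ < 1 ∧ ∀ (N : ℕ) (s : Finset (Fin N)),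
      (Measure.pi fun _ : Fin N => ν).real {x | s.card * c ≤ ∑ i ∈ s, f (x i)} ≤ ρ ^ s.card := by
  obtain ⟨t, ht, hint, hlt⟩ := exists_pos_exp_mul_mgf_lt_one h0 hc
  exact ⟨_, mul_pos (Real.exp_pos _) (mgf_pos hint), hlt,
    fun N s => measureReal_pi_sum_ge_le_pow hf ht.le hint c s⟩

lemma exists_pow_bound_measureReal_pi_iUnion_sum_ge {Ω J : Type*} [MeasurableSpace Ω]
    {ν : Measure Ω} [IsProbabilityMeasure ν] [Fintype J] {f : J → Ω → ℝ}
    (hf : ∀ j, Measurable (f j)) (h0 : ∀ j, 0 ∈ interior (integrableExpSet (f j) ν)) {c : J → ℝ}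
    (hc : ∀ j, ∫ z, f j z ∂ν < c j) :
    ∃ ρ : ℝ, 0 < ρ ∧ ρ < 1 ∧ ∀ (N : ℕ) (s : Finset (Fin N)),
      (Measure.pi fun _ : Fin N => ν).real
        (⋃ j, {x | s.card * c j ≤ ∑ i ∈ s, f j (x i)}) ≤ Fintype.card J * ρ ^ s.card := by
  choose ρ hρ0 hρ1 hρ using fun j => exists_pow_bound_measureReal_pi_sum_ge (hf j) (h0 j) (hc j)
  obtain ⟨r, hr0, hr1, hr⟩ : ∃ r : ℝ, 0 < r ∧ r < 1 ∧ ∀ j, ρ j ≤ r := by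
    cases isEmpty_or_nonempty J
    · exact ⟨1 / 2, by norm_num, by norm_num, isEmptyElim⟩
    · obtain ⟨j₀, hj₀⟩ := Finite.exists_max ρ
      exact ⟨ρ j₀, hρ0 _, hρ1 _, hj₀⟩
  refine ⟨r, hr0, hr1, fun N s => (measureReal_iUnion_fintype_le _).trans ?_⟩
  calc _ ≤ ∑ _j : J, r ^ s.card :=
        Finset.sum_le_sum fun j _ => (hρ j N s).trans (pow_le_pow_left₀ (hρ0 j).le (hr j) _)
    _ = _ := by simp

lemma exists_sum_concentration {Ω J : Type*} [MeasurableSpace Ω] {ν : Measure Ω}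
    [IsProbabilityMeasure ν] [Finite J] {f : J → Ω → ℝ} (hf : ∀ j, Measurable (f j))
    (h0 : ∀ j, 0 ∈ interior (integrableExpSet (f j) ν)) {η : ℝ} (hη : 0 < η) :
    ∃ C ρ : ℝ, 0 ≤ C ∧ 0 < ρ ∧ ρ < 1 ∧ ∀ (N : ℕ) (s : Finset (Fin N)),
      ∃ B : Set (Fin N → Ω), MeasurableSet B ∧
        (Measure.pi fun _ : Fin N => ν).real B ≤ C * ρ ^ s.card ∧
        ∀ x ∉ B, ∀ j, |∑ i ∈ s, f j (x i) - s.card * ∫ z, f j z ∂ν| ≤ s.card * η := by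
  cases nonempty_fintype J
  let g : J ⊕ J → Ω → ℝ := Sum.elim f fun j => -f j
  have hg : ∀ j, Measurable (g j) := Sum.rec hf fun j => (hf j).neg
  have hg0 : ∀ j, 0 ∈ interior (integrableExpSet (g j) ν) := by
    rintro (j | j)
    · exact h0 j
    · rw [mem_interior_iff_mem_nhds]
      filter_upwards [(continuous_neg (G := ℝ)).tendsto' 0 0 neg_zero
        (mem_interior_iff_mem_nhds.1 (h0 j))] with t ht
      simpa [g, integrableExpSet] using ht
  obtain ⟨ρ, hρ0, hρ1, hρ⟩ := exists_pow_bound_measureReal_pi_iUnion_sum_ge hg hg0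
    (c := fun j => ∫ z, g j z ∂ν + η) fun j => lt_add_of_pos_right _ hη
  refine ⟨_, ρ, Nat.cast_nonneg _, hρ0, hρ1, fun N s => ⟨_, ?_, hρ N s, fun x hx j => ?_⟩⟩
  · exact MeasurableSet.iUnion fun j => measurableSet_le measurable_const <|
      Finset.measurable_sum _ fun i _ => (hg j).comp (measurable_pi_apply i)
  · simp only [Set.mem_iUnion, Set.mem_ofPred_eq, not_exists, not_le] at hx
    have hupper := hx (.inl j)
    have hlower := hx (.inr j)
    simp only [g, Sum.elim_inl, Sum.elim_inr, Pi.neg_apply, integral_neg,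
      Finset.sum_neg_distrib] at hupper hlower
    rw [abs_le]
    constructor <;> linarith

variable {d : ℕ}

lemma inner_sq_eq_sum_sum (x v : Vec d) :
    inner ℝ x v ^ 2 = ∑ a, ∑ b, v a * v b * (x a * x b) := by
  rw [sq, PiLp.inner_apply, Finset.sum_mul_sum]
  simp only [RCLike.inner_apply, conj_trivial]
  exact Finset.sum_congr rfl fun a _ => Finset.sum_congr rfl fun b _ => by ring

lemma abs_sum_sum_mul_le {A : Fin d → Fin d → ℝ} {η : ℝ} (hA : ∀ a b, |A a b| ≤ η) (v : Vec d) :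
    |∑ a, ∑ b, v a * v b * A a b| ≤ d ^ 2 * η * ‖v‖ ^ 2 := by
  have hv (a : Fin d) : |v a| ≤ ‖v‖ := PiLp.norm_apply_le v a
  calc |∑ a, ∑ b, v a * v b * A a b| ≤ ∑ a, ∑ b, |v a * v b * A a b| :=
        (Finset.abs_sum_le_sum_abs _ _).trans <|
          Finset.sum_le_sum fun a _ => Finset.abs_sum_le_sum_abs _ _
    _ ≤ ∑ _a : Fin d, ∑ _b : Fin d, ‖v‖ * ‖v‖ * η := by
        simp_rw [abs_mul]
        gcongr with a _ b _
        exacts [hv a, hv b, hA a b]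
    _ = d ^ 2 * η * ‖v‖ ^ 2 := by
        simp only [Finset.sum_const, Finset.card_univ, Fintype.card_fin, nsmul_eq_mul]; ring

lemma integral_apply_mul_apply (m : Vec d) (τ : ℝ) (a b : Fin d) :
    ∫ x : Vec d, x a * x b ∂(isoGaussian m τ) = τ ^ 2 * (if a = b then 1 else 0) + m a * m b := by
  simpa [EuclideanSpace.inner_single_left, PiLp.single_apply, eq_comm] using
    integral_inner_mul_inner m (EuclideanSpace.single a 1) (EuclideanSpace.single b 1) τ

lemma sum_sum_integral_apply_mul_apply (m : Vec d) (τ : ℝ) (v : Vec d) :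
    ∑ a, ∑ b, v a * v b * ∫ x : Vec d, x a * x b ∂(isoGaussian m τ) =
      τ ^ 2 * ‖v‖ ^ 2 + inner ℝ m v ^ 2 := by
  simp_rw [integral_apply_mul_apply, mul_add, Finset.sum_add_distrib, ← inner_sq_eq_sum_sum]
  congr 1
  rw [EuclideanSpace.real_norm_sq_eq, Finset.mul_sum]
  refine Finset.sum_congr rfl fun a _ => ?_
  simp only [mul_ite, mul_one, mul_zero, Finset.sum_ite_eq, Finset.mem_univ, if_true]
  ring

lemma exists_second_moment_concentration (m : Vec d) (τ : ℝ) {ε : ℝ} (hε : 0 < ε) :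
    ∃ C ρ : ℝ, 0 ≤ C ∧ 0 < ρ ∧ ρ < 1 ∧ ∀ (N : ℕ) (s : Finset (Fin N)),
      ∃ B : Set (Fin N → Vec d), MeasurableSet B ∧
        (Measure.pi fun _ : Fin N => isoGaussian m τ).real B ≤ C * ρ ^ s.card ∧
        ∀ x ∉ B, ∀ v : Vec d,
          |∑ i ∈ s, inner ℝ (x i) v ^ 2 - s.card * (τ ^ 2 * ‖v‖ ^ 2 + inner ℝ m v ^ 2)| ≤
            s.card * ε * ‖v‖ ^ 2 := by
  have hexp (j : Fin d × Fin d) :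
      0 ∈ interior (integrableExpSet (fun x : Vec d => x j.1 * x j.2) (isoGaussian m τ)) := by
    refine zero_mem_interior_integrableExpSet_of_isGaussian _ (by fun_prop) (A := 1) fun x => ?_
    calc |x j.1 * x j.2| ≤ ‖x‖ * ‖x‖ := by
          rw [abs_mul]
          exact mul_le_mul (PiLp.norm_apply_le x j.1) (PiLp.norm_apply_le x j.2) (abs_nonneg _)
            (norm_nonneg x)
      _ ≤ 1 * (1 + ‖x‖ ^ 2) := by linarith
  obtain ⟨C, ρ, hC, hρ0, hρ1, hconc⟩ := exists_sum_concentration (fun j => by fun_prop) hexp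
    (show 0 < ε / (d ^ 2 + 1) by positivity)
  refine ⟨C, ρ, hC, hρ0, hρ1, fun N s => ?_⟩
  obtain ⟨B, hB, hPB, hdev⟩ := hconc N s
  refine ⟨B, hB, hPB, fun x hx v => ?_⟩
  have hform : ∑ i ∈ s, inner ℝ (x i) v ^ 2 - s.card * (τ ^ 2 * ‖v‖ ^ 2 + inner ℝ m v ^ 2) =
      ∑ a, ∑ b, v a * v b *
        (∑ i ∈ s, x i a * x i b - s.card * ∫ z : Vec d, z a * z b ∂(isoGaussian m τ)) := by
    simp_rw [← sum_sum_integral_apply_mul_apply, inner_sq_eq_sum_sum, mul_sub,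
      Finset.sum_sub_distrib, Finset.mul_sum]
    congr 1
    · rw [Finset.sum_comm]
      exact Finset.sum_congr rfl fun a _ => Finset.sum_comm
    · simp_rw [mul_left_comm]
  rw [hform]
  refine (abs_sum_sum_mul_le (fun a b => hdev x hx (a, b)) v).trans ?_
  rw [mul_left_comm]
  gcongr
  rw [mul_div_assoc', div_le_iff₀ (by positivity)]
  linarith

lemma exists_mean_concentration {J : Type*} [Finite J] (m : Vec d) (τ : ℝ) (a : J → Vec d)
    {η : ℝ} (hη : 0 < η) :
    ∃ C ρ : ℝ, 0 ≤ C ∧ 0 < ρ ∧ ρ < 1 ∧ ∀ N : ℕ,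
      ∃ B : Set (Fin N → Vec d), MeasurableSet B ∧
        (Measure.pi fun _ : Fin N => isoGaussian m τ).real B ≤ C * ρ ^ N ∧
        ∀ x ∉ B, ∀ j, |inner ℝ (a j) (∑ i, (x i - m))| ≤ N * η := by
  have hexp (j : J) :
      0 ∈ interior (integrableExpSet (fun x => inner ℝ (a j) (x - m)) (isoGaussian m τ)) := by
    refine zero_mem_interior_integrableExpSet_of_isGaussian _ (by fun_prop)
      (A := ‖a j‖ * (1 + ‖m‖)) fun x => (abs_real_inner_le_norm _ _).trans ?_
    rw [mul_assoc]
    gcongr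
    calc ‖x - m‖ ≤ ‖x‖ + ‖m‖ := norm_sub_le x m
      _ ≤ (1 + ‖x‖ ^ 2) + ‖m‖ * (1 + ‖x‖ ^ 2) := by
        gcongr
        · nlinarith [sq_nonneg (‖x‖ - 1)]
        · exact le_mul_of_one_le_right (norm_nonneg m) (by linarith [sq_nonneg ‖x‖])
      _ = (1 + ‖m‖) * (1 + ‖x‖ ^ 2) := by ring
  have hzero (j : J) : ∫ x, inner ℝ (a j) (x - m) ∂(isoGaussian m τ) = 0 := by
    simp_rw [inner_sub_right]
    rw [integral_sub ((memLp_inner_isoGaussian m (a j) τ).integrable one_le_two)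
      (integrable_const _), integral_inner_isoGaussian, integral_const, probReal_univ, one_smul,
      sub_self]
  obtain ⟨C, ρ, hC, hρ0, hρ1, hconc⟩ := exists_sum_concentration (fun j => by fun_prop) hexp hη
  refine ⟨C, ρ, hC, hρ0, hρ1, fun N => ?_⟩
  simpa only [hzero, inner_sum, mul_zero, sub_zero, Finset.card_univ, Fintype.card_fin] using
    hconc N Finset.univ

lemma exists_prompt_concentration {J : Type*} [Finite J] {m : Vec d} (hm : ‖m‖ ≤ 1) (τ : ℝ)
    (a : J → Vec d) {ε η : ℝ} (hε : 0 < ε) (hη : 0 < η) :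
    ∃ C ρ : ℝ, 0 ≤ C ∧ 0 < ρ ∧ ρ < 1 ∧ ∀ k : ℕ, ∃ B : Set (Fin (k + 1) → Vec d),
      MeasurableSet B ∧
      (Measure.pi fun _ : Fin (k + 1) => isoGaussian m τ).real B ≤ C * ρ ^ k ∧
      ∀ x ∉ B,
        (∀ v, k * (τ ^ 2 - ε) * ‖v‖ ^ 2 ≤ ∑ i : Fin k, inner ℝ (x i.castSucc) v ^ 2) ∧
        (∀ v, ∑ i : Fin k, inner ℝ (x i.castSucc) v ^ 2 ≤ k * (1 + τ ^ 2 + ε) * ‖v‖ ^ 2) ∧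
        ∀ j, inner ℝ (a j) (∑ i, (x i - m)) ≤ (k + 1 : ℕ) * η := by
  obtain ⟨C₁, ρ₁, hC₁, hρ₁, hρ₁', hsecond⟩ := exists_second_moment_concentration m τ hε
  obtain ⟨C₂, ρ₂, hC₂, hρ₂, hρ₂', hmean⟩ := exists_mean_concentration m τ a hη
  refine ⟨C₁ + C₂, max ρ₁ ρ₂, by positivity, lt_max_of_lt_left hρ₁, max_lt hρ₁' hρ₂', fun k => ?_⟩
  obtain ⟨B₁, hB₁, hP₁, hx₁⟩ := hsecond (k + 1) (Finset.univ.map Fin.castSuccEmb)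
  obtain ⟨B₂, hB₂, hP₂, hx₂⟩ := hmean (k + 1)
  simp only [Finset.card_map, Finset.card_univ, Fintype.card_fin, Finset.sum_map,
    Fin.coe_castSuccEmb] at hP₁ hx₁
  refine ⟨B₁ ∪ B₂, hB₁.union hB₂, (measureReal_union_le _ _).trans ?_, fun x hx => ?_⟩
  · rw [add_mul]
    refine add_le_add (hP₁.trans (by gcongr; exact le_max_left _ _)) (hP₂.trans ?_)
    calc C₂ * ρ₂ ^ (k + 1) ≤ C₂ * ρ₂ ^ k :=
          mul_le_mul_of_nonneg_left (pow_le_pow_of_le_one hρ₂.le hρ₂'.le k.le_succ) hC₂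
      _ ≤ C₂ * max ρ₁ ρ₂ ^ k := by gcongr; exact le_max_right _ _
  · rw [Set.mem_union, not_or] at hx
    have hdev (v : Vec d) := abs_le.1 (hx₁ x hx.1 v)
    have hinner (v : Vec d) : (k : ℝ) * inner ℝ m v ^ 2 ≤ k * ‖v‖ ^ 2 := by
      gcongr k * ?_
      exact (real_inner_sq_le m v).trans <|
        mul_le_of_le_one_left (sq_nonneg _) (pow_le_one₀ (norm_nonneg m) hm)
    refine ⟨fun v => ?_, fun v => ?_, fun j => le_of_abs_le (hx₂ x hx.2 j)⟩
    · have : 0 ≤ (k : ℝ) * inner ℝ m v ^ 2 := by positivity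
      linarith [(hdev v).1]
    · linarith [(hdev v).2, hinner v]

end Concentration

section EnergyGap

lemma le_meanEnergy_sub {ι E : Type*} [Fintype ι] [NormedAddCommGroup E] [InnerProductSpace ℝ E]
    {σμ σx : ℝ} (hσx : 0 < σx) {μs μα μβ : E} {x : ι → E} {D : ℝ} (hD0 : 0 ≤ D)
    (hD : D ≤ ‖μβ - μs‖ ^ 2 - ‖μα - μs‖ ^ 2)
    (hmean : inner ℝ (μβ - μα) (∑ i, (x i - μs)) ≤ Fintype.card ι * (D / 4))
    (hcard : Fintype.card ι * (σμ ^ 2 / σx ^ 2) ≤ 1) :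
    Fintype.card ι * (D / (8 * σx ^ 2)) ≤
      meanEnergy σμ σx μs x μβ - meanEnergy σμ σx μs x μα := by
  set N : ℝ := (Fintype.card ι : ℝ) with hN
  set r := N * (σμ ^ 2 / σx ^ 2)
  have hr : 0 ≤ r := by positivity
  have hinner : inner ℝ (μβ - μα) (∑ i, (x i - μs)) =
      inner ℝ (μβ - μs) (∑ i, (x i - μs)) - inner ℝ (μα - μs) (∑ i, (x i - μs)) := by
    rw [← inner_sub_left, sub_sub_sub_cancel_right]
  rw [meanEnergy, meanEnergy, ← hN, ← sub_div, le_div_iff₀ (by positivity)]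
  calc N * (D / (8 * σx ^ 2)) * (2 * σx ^ 2 * (1 + r)) = N * D * (1 + r) / 4 := by
        field_simp
        ring
    _ ≤ N * D * 2 / 4 := by gcongr; linarith
    _ ≤ N * ‖μβ - μs‖ ^ 2 - 2 * inner ℝ (μβ - μs) (∑ i, (x i - μs)) -
          (N * ‖μα - μs‖ ^ 2 - 2 * inner ℝ (μα - μs) (∑ i, (x i - μs))) := by
        have hmargin : N * D ≤ N * (‖μβ - μs‖ ^ 2 - ‖μα - μs‖ ^ 2) := by gcongr
        linarith

lemma IsRidgeSolution.regressionEnergy_le {ι E : Type*} [Fintype ι] [NormedAddCommGroup E]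
    [InnerProductSpace ℝ E] {δ σw a b : ℝ} (hδ : 0 ≤ δ) {x : ι → E} {e u e' u' : E}
    (hu : IsRidgeSolution δ x e u) (hu' : IsRidgeSolution δ x e' u') (ha0 : 0 ≤ a) (hab : a ≤ b)
    (ha : ∀ v, a * ‖v‖ ^ 2 ≤ ∑ i, inner ℝ (x i) v ^ 2)
    (hb : ∀ v, ∑ i, inner ℝ (x i) v ^ 2 ≤ b * ‖v‖ ^ 2) (hle : b * ‖e‖ ^ 2 ≤ a * ‖e'‖ ^ 2) :
    regressionEnergy σw e u ≤ regressionEnergy σw e' u' :=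
  div_le_div_of_nonneg_right (hu.residual_le hδ hu' ha0 hab ha hb hle) (by positivity)

end EnergyGap

section PromptError

variable {d M : ℕ} {p : Fin M → ℝ} {μc wc : Fin M → Vec d} {σμ σw σx σy : ℝ}
  {F : Predictor d}

/-- The signed error of the predictor `F` at the query `x (Fin.last k)`, relative to the linear
function with coefficient vector `v`, when the preceding inputs carry the noiseless labels
`⟨xᵢ, ws⟩`. The risk `iclRisk` is the expectation of its square. -/
def promptError (F : Predictor d) (ws v : Vec d) {k : ℕ} (x : Fin (k + 1) → Vec d) : ℝ :=
  F k (fun i => (x i.castSucc, inner ℝ (x i.castSucc) ws)) (x (Fin.last k)) -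
    inner ℝ (x (Fin.last k)) v

lemma norm_sum_smul_sq_le_of_le {ι E : Type*} [Fintype ι] [SeminormedAddCommGroup E]
    [NormedSpace ℝ E] {q : ι → ℝ} (hq : ∀ i, 0 ≤ q i) (hq_sum : ∑ i, q i = 1) {v : ι → E} {r D : ℝ}
    {α : ι} (hr0 : 0 ≤ r) (hr : ∀ i, i ≠ α → q i ≤ r) (hv : ∀ i, ‖v i‖ ≤ D) :
    ‖∑ i, q i • v i‖ ^ 2 ≤ ‖v α‖ ^ 2 + Fintype.card ι * (r * D ^ 2) := by
  classical
  have hterm (i : ι) : q i * ‖v i‖ ^ 2 ≤ (if i = α then ‖v α‖ ^ 2 else 0) + r * D ^ 2 := by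
    have hD : 0 ≤ r * D ^ 2 := by positivity
    split_ifs with hi
    · subst hi
      have hqi : q i ≤ 1 := hq_sum ▸ Finset.single_le_sum (fun j _ => hq j) (Finset.mem_univ i)
      linarith [mul_le_of_le_one_left (sq_nonneg ‖v i‖) hqi]
    · rw [zero_add]
      exact mul_le_mul (hr i hi) (pow_le_pow_left₀ (norm_nonneg _) (hv i) 2) (sq_nonneg _) hr0
  calc ‖∑ i, q i • v i‖ ^ 2 ≤ ∑ i, q i * ‖v i‖ ^ 2 := norm_sum_smul_sq_le hq hq_sum v
    _ ≤ ∑ i, ((if i = α then ‖v α‖ ^ 2 else 0) + r * D ^ 2) := Finset.sum_le_sum fun i _ => hterm i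
    _ = ‖v α‖ ^ 2 + Fintype.card ι * (r * D ^ 2) := by
        rw [Finset.sum_add_distrib, Finset.sum_ite_eq', if_pos (Finset.mem_univ α),
          Finset.sum_const, Finset.card_univ, nsmul_eq_mul]

lemma IsOptimalPredictor.promptError_eq (hp : ∀ m, 0 < p m) (hsum : ∑ m, p m = 1)
    (hσμ : 0 < σμ) (hσw : 0 < σw) (hσx : 0 < σx) (hσy : 0 < σy)
    (hF : IsOptimalPredictor (taskPrior p μc wc σμ σw) σx σy F) (μs ws v : Vec d) {k : ℕ}
    (x : Fin (k + 1) → Vec d) {u : Fin M → Vec d}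
    (hu : ∀ m, IsRidgeSolution (σw ^ 2 / σy ^ 2) (fun i : Fin k => x i.castSucc) (wc m - ws)
      (u m)) :
    promptError F ws v x = inner ℝ (∑ m, gibbsWeight p
      (fun m => energy σμ σw σx μs x (μc m) (wc m - ws) (u m)) m • u m - (v - ws))
      (x (Fin.last k)) := by
  rw [promptError, hF.eq_inner hp hsum hσμ hσw hσx hσy μs ws x hu,
    real_inner_comm v (x (Fin.last k)), ← inner_sub_left]
  congr 1
  abel

lemma IsOptimalPredictor.promptError_sq_le (hp : ∀ m, 0 < p m) (hsum : ∑ m, p m = 1)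
    (hσμ : 0 < σμ) (hσw : 0 < σw) (hσx : 0 < σx) (hσy : 0 < σy)
    (hF : IsOptimalPredictor (taskPrior p μc wc σμ σw) σx σy F) {ws : Vec d} {R : ℝ}
    (hR : ∀ m, ‖wc m - ws‖ ≤ R) (α : Fin M) {k : ℕ} (x : Fin (k + 1) → Vec d) :
    promptError F ws (wc α) x ^ 2 ≤ (2 * R) ^ 2 * ‖x (Fin.last k)‖ ^ 2 := by
  have hδ : 0 ≤ σw ^ 2 / σy ^ 2 := by positivity
  choose u hu using fun m =>
    exists_isRidgeSolution hδ (fun i : Fin k => x i.castSucc) (wc m - ws)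
  rw [hF.promptError_eq hp hsum hσμ hσw hσx hσy 0 ws (wc α) x hu]
  refine (real_inner_sq_le _ _).trans ?_
  gcongr
  have hmix := norm_sum_smul_le (gibbsWeight_nonneg hp _) (sum_gibbsWeight hp hsum
    fun m => energy σμ σw σx 0 x (μc m) (wc m - ws) (u m)) fun m =>
    ((hu m).norm_le hδ).trans (hR m)
  linarith [norm_sub_le (∑ m, gibbsWeight p
    (fun m => energy σμ σw σx 0 x (μc m) (wc m - ws) (u m)) m • u m) (wc α - ws), hR α]

lemma IsOptimalPredictor.promptError_sq_le_of_margin (hp : ∀ m, 0 < p m) (hsum : ∑ m, p m = 1)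
    (hσμ : 0 < σμ) (hσw : 0 < σw) (hσx : 0 < σx) (hσy : 0 < σy)
    (hF : IsOptimalPredictor (taskPrior p μc wc σμ σw) σx σy F) {μs ws : Vec d} {R : ℝ}
    (hR : ∀ m, ‖wc m - ws‖ ≤ R) (α : Fin M) {k : ℕ} (x : Fin (k + 1) → Vec d) {a b : ℝ}
    (ha0 : 0 ≤ a) (hab : a ≤ b)
    (ha : ∀ v, a * ‖v‖ ^ 2 ≤ ∑ i : Fin k, inner ℝ (x i.castSucc) v ^ 2)
    (hb : ∀ v, ∑ i : Fin k, inner ℝ (x i.castSucc) v ^ 2 ≤ b * ‖v‖ ^ 2)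
    (hle : ∀ β, β ≠ α → b * ‖wc α - ws‖ ^ 2 ≤ a * ‖wc β - ws‖ ^ 2) {D : ℝ} (hD0 : 0 ≤ D)
    (hD : ∀ β, β ≠ α → D ≤ ‖μc β - μs‖ ^ 2 - ‖μc α - μs‖ ^ 2)
    (hmean : ∀ β, inner ℝ (μc β - μc α) (∑ i, (x i - μs)) ≤ (k + 1 : ℕ) * (D / 4))
    (hk : (k + 1 : ℕ) * (σμ ^ 2 / σx ^ 2) ≤ 1) :
    promptError F ws (wc α) x ^ 2 ≤
      (‖wc α - ws‖ ^ 2 * min 1 ((σw ^ 2 / σy ^ 2 * b) ^ 2) +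
        M * ((p α)⁻¹ * Real.exp (-((k + 1 : ℕ) * (D / (8 * σx ^ 2)))) * (2 * R) ^ 2)) *
        ‖x (Fin.last k)‖ ^ 2 := by
  have hδ : 0 ≤ σw ^ 2 / σy ^ 2 := by positivity
  choose u hu using fun m =>
    exists_isRidgeSolution hδ (fun i : Fin k => x i.castSucc) (wc m - ws)
  rw [hF.promptError_eq hp hsum hσμ hσw hσx hσy μs ws (wc α) x hu]
  set H : Fin M → ℝ := fun m => energy σμ σw σx μs x (μc m) (wc m - ws) (u m)
  have hgap (β : Fin M) (hβ : β ≠ α) : (k + 1 : ℕ) * (D / (8 * σx ^ 2)) ≤ H β - H α := by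
    have hmeanEnergy := le_meanEnergy_sub hσx hD0 (hD β hβ) (x := x) (σμ := σμ)
      (by simpa only [Fintype.card_fin] using hmean β) (by simpa only [Fintype.card_fin] using hk)
    have hregression := (hu α).regressionEnergy_le (σw := σw) hδ (hu β) ha0 hab ha hb (hle β hβ)
    rw [Fintype.card_fin] at hmeanEnergy
    simp only [H, energy]
    linarith
  have hbias : ∑ m, gibbsWeight p H m • u m - (wc α - ws) =
      ∑ m, gibbsWeight p H m • (u m - (wc α - ws)) := by
    rw [Finset.sum_congr rfl fun m _ => smul_sub _ (u m) _, Finset.sum_sub_distrib,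
      ← Finset.sum_smul, sum_gibbsWeight hp hsum, one_smul]
  have hridge : ‖u α - (wc α - ws)‖ ^ 2 ≤
      ‖wc α - ws‖ ^ 2 * min 1 ((σw ^ 2 / σy ^ 2 * b) ^ 2) := by
    rw [mul_min_of_nonneg _ _ (sq_nonneg _), mul_one, ← mul_pow, mul_comm ‖wc α - ws‖]
    exact le_min (pow_le_pow_left₀ (norm_nonneg _) ((hu α).norm_sub_le hδ) 2) <|
      pow_le_pow_left₀ (norm_nonneg _) ((hu α).norm_sub_le_mul hδ (ha0.trans hab) hb) 2
  have hpα : 0 < p α := hp α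
  have hmix := norm_sum_smul_sq_le_of_le (gibbsWeight_nonneg hp H) (sum_gibbsWeight hp hsum H)
    (by positivity) (fun β hβ => gibbsWeight_le hp hsum (hgap β hβ))
    (v := fun m => u m - (wc α - ws)) (D := 2 * R) fun m => (norm_sub_le _ _).trans <| by
      linarith [((hu m).norm_le hδ).trans (hR m), hR α]
  rw [Fintype.card_fin] at hmix
  rw [hbias]
  refine (real_inner_sq_le _ _).trans ?_
  gcongr
  exact hmix.trans (by gcongr)

lemma IsOptimalPredictor.promptError_sq_le_of_lower_bound (hp : ∀ m, 0 < p m)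
    (hsum : ∑ m, p m = 1) (hσμ : 0 < σμ) (hσw : 0 < σw) (hσx : 0 < σx) (hσy : 0 < σy)
    (hF : IsOptimalPredictor (taskPrior p μc wc σμ σw) σx σy F) {ws : Vec d} {R : ℝ}
    (hR : ∀ m, ‖wc m - ws‖ ≤ R) (v : Vec d) {k : ℕ} (x : Fin (k + 1) → Vec d) {a : ℝ} (ha0 : 0 ≤ a)
    (ha : ∀ v, a * ‖v‖ ^ 2 ≤ ∑ i : Fin k, inner ℝ (x i.castSucc) v ^ 2) {η : ℝ} (hη : 0 < η) :
    promptError F ws v x ^ 2 ≤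
      ((1 + η) * ‖v - ws‖ ^ 2 + (1 + η⁻¹) * (R / (1 + σw ^ 2 / σy ^ 2 * a)) ^ 2) *
        ‖x (Fin.last k)‖ ^ 2 := by
  have hδ : 0 ≤ σw ^ 2 / σy ^ 2 := by positivity
  choose u hu using fun m =>
    exists_isRidgeSolution hδ (fun i : Fin k => x i.castSucc) (wc m - ws)
  rw [hF.promptError_eq hp hsum hσμ hσw hσx hσy 0 ws v x hu]
  set S := ∑ m, gibbsWeight p
    (fun m => energy σμ σw σx 0 x (μc m) (wc m - ws) (u m)) m • u m
  have hS : ‖S‖ ≤ R / (1 + σw ^ 2 / σy ^ 2 * a) :=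
    norm_sum_smul_le (gibbsWeight_nonneg hp _) (sum_gibbsWeight hp hsum _) fun m => by
      rw [le_div_iff₀' (by positivity)]
      exact ((hu m).mul_norm_le hδ ha).trans (hR m)
  refine (real_inner_sq_le _ _).trans ?_
  gcongr
  calc ‖S - (v - ws)‖ ^ 2 ≤ (‖S‖ + ‖v - ws‖) ^ 2 := by gcongr; exact norm_sub_le _ _
    _ = (1 + η) * ‖v - ws‖ ^ 2 + (1 + η⁻¹) * ‖S‖ ^ 2 - η⁻¹ * (‖S‖ - η * ‖v - ws‖) ^ 2 := by
        field_simp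
        ring
    _ ≤ (1 + η) * ‖v - ws‖ ^ 2 + (1 + η⁻¹) * ‖S‖ ^ 2 := sub_le_self _ (by positivity)
    _ ≤ _ := by gcongr

end PromptError

section RiskBounds

lemma lintegral_ofReal_le_of_event {Ω : Type*} [MeasurableSpace Ω] {P : Measure Ω}
    [IsFiniteMeasure P] {g h w : Ω → ℝ} {b l : ℝ} (hb : 0 ≤ b) (hl : 0 < l) (hh0 : ∀ x, 0 ≤ h x)
    (hh : Integrable h P) (hw : Integrable (fun x => w x ^ 2) P) {B : Set Ω}
    (hB : MeasurableSet B) (hgood : ∀ x ∉ B, g x ≤ h x) (hbad : ∀ x, g x ≤ b * w x) :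
    ∫⁻ x, ENNReal.ofReal (g x) ∂P ≤
      ENNReal.ofReal (∫ x, h x ∂P + b / 2 * (l * P.real B + (∫ x, w x ^ 2 ∂P) / l)) := by
  have hind : Integrable (fun x => l * B.indicator 1 x) P :=
    ((integrable_const 1).indicator hB).const_mul l
  have hrest : Integrable (fun x => b / 2 * (l * B.indicator 1 x + w x ^ 2 / l)) P :=
    (hind.add (hw.div_const l)).const_mul (b / 2)
  have hind0 (x : Ω) : 0 ≤ B.indicator (1 : Ω → ℝ) x :=
    Set.indicator_nonneg (fun _ _ => zero_le_one) x
  have hrest0 (x : Ω) : 0 ≤ b / 2 * (l * B.indicator 1 x + w x ^ 2 / l) :=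
    mul_nonneg (by positivity) (add_nonneg (mul_nonneg hl.le (hind0 x)) (by positivity))
  have hle (x : Ω) : g x ≤ h x + b / 2 * (l * B.indicator 1 x + w x ^ 2 / l) := by
    by_cases hx : x ∈ B
    · have hamgm : b * w x = b / 2 * (l * 1 + w x ^ 2 / l) - b / 2 * ((w x - l) ^ 2 / l) := by
        field_simp
        ring
      rw [Set.indicator_of_mem hx, Pi.one_apply]
      have hsq : 0 ≤ b / 2 * ((w x - l) ^ 2 / l) := by positivity
      linarith [hbad x, hh0 x]
    · linarith [hgood x hx, hrest0 x]
  calc ∫⁻ x, ENNReal.ofReal (g x) ∂P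
      ≤ ∫⁻ x, ENNReal.ofReal (h x + b / 2 * (l * B.indicator 1 x + w x ^ 2 / l)) ∂P :=
        lintegral_mono fun x => ENNReal.ofReal_le_ofReal (hle x)
    _ = ENNReal.ofReal (∫ x, (h x + b / 2 * (l * B.indicator 1 x + w x ^ 2 / l)) ∂P) :=
        (ofReal_integral_eq_lintegral_ofReal (hh.add hrest)
          (ae_of_all _ fun x => add_nonneg (hh0 x) (hrest0 x))).symm
    _ = _ := by
        rw [integral_add hh hrest, integral_const_mul, integral_add hind (hw.div_const l),
          integral_const_mul, integral_div, integral_indicator_one hB]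

lemma exists_exp_sqrt_mul_pow_le {ρ : ℝ} (hρ0 : 0 < ρ) (hρ1 : ρ < 1) :
    ∃ K : ℝ, 0 < K ∧ ∀ k : ℕ, Real.exp (√k / 8) * ρ ^ k ≤ K * Real.exp (-√k / 8) := by
  obtain ⟨c, hc, hρ⟩ : ∃ c, 0 < c ∧ Real.log ρ = -c :=
    ⟨-Real.log ρ, neg_pos.2 (Real.log_neg hρ0 hρ1), (neg_neg _).symm⟩
  refine ⟨Real.exp (1 / (64 * c)), Real.exp_pos _, fun k => ?_⟩
  rw [← Real.exp_log (pow_pos hρ0 k), Real.log_pow, hρ, ← Real.exp_add, ← Real.exp_add,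
    Real.exp_le_exp, ← sub_nonneg]
  calc 0 ≤ c * (√k - 1 / (8 * c)) ^ 2 := by positivity
    _ = 1 / (64 * c) + -√k / 8 - (√k / 8 + √k ^ 2 * -c) := by
        field_simp
        ring
    _ = _ := by rw [Real.sq_sqrt (Nat.cast_nonneg k)]

variable {d M : ℕ}

lemma iclRisk_le_of_event (F : Predictor d) {m : Vec d} (hm : ‖m‖ ≤ 1) (ws v : Vec d) (τ : ℝ)
    {k : ℕ} {B : Set (Fin (k + 1) → Vec d)} (hB : MeasurableSet B) {b l H : ℝ} (hb : 0 ≤ b)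
    (hl : 0 < l) (hH : 0 ≤ H)
    (hgood : ∀ x ∉ B, promptError F ws v x ^ 2 ≤ H * ‖x (Fin.last k)‖ ^ 2)
    (hbad : ∀ x : Fin (k + 1) → Vec d, promptError F ws v x ^ 2 ≤ b * ‖x (Fin.last k)‖ ^ 2) :
    iclRisk F m ws τ v k ≤ ENNReal.ofReal (H * (1 + d * τ ^ 2) +
      b / 2 * (l * (Measure.pi fun _ : Fin (k + 1) => isoGaussian m τ).real B +
        (∫ y, ‖y‖ ^ 4 ∂(isoGaussian m τ)) / l)) := by
  have hquery := measurePreserving_eval (fun _ : Fin (k + 1) => isoGaussian m τ) (Fin.last k)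
  have hsq := integrable_norm_pow_isoGaussian m τ 2
  have hfourth : Integrable (fun y => (‖y‖ ^ 2) ^ 2) (isoGaussian m τ) := by
    simpa only [← pow_mul] using integrable_norm_pow_isoGaussian m τ 4
  refine (lintegral_ofReal_le_of_event hb hl
    (h := fun x : Fin (k + 1) → Vec d => H * ‖x (Fin.last k)‖ ^ 2) (fun x => by positivity)
    (hquery.integrable_comp_of_integrable (hsq.const_mul H))
    (hquery.integrable_comp_of_integrable hfourth) hB hgood hbad).trans
    (ENNReal.ofReal_le_ofReal (add_le_add ?_ (le_of_eq ?_)))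
  · rw [integral_comp_eval (μ := fun _ : Fin (k + 1) => isoGaussian m τ) (i := Fin.last k)
      (f := fun y => H * ‖y‖ ^ 2) (hsq.const_mul H).aestronglyMeasurable, integral_const_mul,
      integral_norm_sq_isoGaussian]
    gcongr
    exact pow_le_one₀ (norm_nonneg m) hm
  · rw [integral_comp_eval (μ := fun _ : Fin (k + 1) => isoGaussian m τ) (i := Fin.last k)
      (f := fun y => (‖y‖ ^ 2) ^ 2) hfourth.aestronglyMeasurable]
    simp only [← pow_mul, Nat.reduceMul]

lemma exists_iclRisk_le_of_concentrated {J : Type*} [Finite J] {m : Vec d} (hm : ‖m‖ ≤ 1) (τ : ℝ)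
    (a : J → Vec d) {ε η b : ℝ} (hε : 0 < ε) (hη : 0 < η) (hb : 0 ≤ b) :
    ∃ K : ℝ, 0 ≤ K ∧ ∀ (F : Predictor d) (ws v : Vec d) (k : ℕ) (H : ℝ), 0 ≤ H →
      (∀ x : Fin (k + 1) → Vec d,
        (∀ v, k * (τ ^ 2 - ε) * ‖v‖ ^ 2 ≤ ∑ i : Fin k, inner ℝ (x i.castSucc) v ^ 2) →
        (∀ v, ∑ i : Fin k, inner ℝ (x i.castSucc) v ^ 2 ≤ k * (1 + τ ^ 2 + ε) * ‖v‖ ^ 2) →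
        (∀ j, inner ℝ (a j) (∑ i, (x i - m)) ≤ (k + 1 : ℕ) * η) →
        promptError F ws v x ^ 2 ≤ H * ‖x (Fin.last k)‖ ^ 2) →
      (∀ x : Fin (k + 1) → Vec d, promptError F ws v x ^ 2 ≤ b * ‖x (Fin.last k)‖ ^ 2) →
      iclRisk F m ws τ v k ≤
        ENNReal.ofReal (H * (1 + d * τ ^ 2) + K * Real.exp (-√k / 8)) := by
  obtain ⟨C, ρ, hC, hρ0, hρ1, hconc⟩ := exists_prompt_concentration hm τ a hε hη
  obtain ⟨K, hK, hpow⟩ := exists_exp_sqrt_mul_pow_le hρ0 hρ1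
  refine ⟨b / 2 * (C * K + ∫ y, ‖y‖ ^ 4 ∂(isoGaussian m τ)),
    mul_nonneg (by positivity) <|
      add_nonneg (by positivity) (integral_nonneg fun y => by positivity),
    fun F ws v k H hH hgood hbad => ?_⟩
  obtain ⟨B, hB, hPB, hx⟩ := hconc k
  refine (iclRisk_le_of_event F hm ws v τ hB hb (Real.exp_pos (√k / 8)) hH
    (fun x hxB => hgood x (hx x hxB).1 (hx x hxB).2.1 (hx x hxB).2.2) hbad).trans
    (ENNReal.ofReal_le_ofReal ?_)
  rw [mul_assoc (b / 2), add_mul, div_eq_mul_inv (∫ y, ‖y‖ ^ 4 ∂(isoGaussian m τ)),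
    ← Real.exp_neg, ← neg_div]
  refine add_le_add_right (mul_le_mul_of_nonneg_left (add_le_add_left ?_ _) (by positivity)) _
  calc Real.exp (√k / 8) * (Measure.pi fun _ : Fin (k + 1) => isoGaussian m τ).real B
      ≤ Real.exp (√k / 8) * (C * ρ ^ k) := by gcongr
    _ = C * (Real.exp (√k / 8) * ρ ^ k) := mul_left_comm _ _ _
    _ ≤ C * (K * Real.exp (-√k / 8)) := mul_le_mul_of_nonneg_left (hpow k) hC
    _ = C * K * Real.exp (-√k / 8) := (mul_assoc _ _ _).symm

lemma exists_exp_neg_succ_mul_le {c : ℝ} (hc : 0 < c) :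
    ∃ K : ℝ, 0 < K ∧
      ∀ k : ℕ, Real.exp (-((k + 1 : ℕ) * c)) ≤ K * Real.exp (-√k / 8) := by
  obtain ⟨K, hK, hpow⟩ := exists_exp_sqrt_mul_pow_le (Real.exp_pos (-c))
    (Real.exp_lt_one_iff.2 (neg_lt_zero.2 hc))
  refine ⟨K, hK, fun k => le_trans ?_ (hpow k)⟩
  rw [← Real.exp_nat_mul, ← Real.exp_add, Real.exp_le_exp]
  push_cast
  linarith [Real.sqrt_nonneg (k : ℝ)]

lemma exists_pos_forall_add_mul_lt_sub_mul {ι : Type*} [Finite ι] {A s t : ℝ} (ht : 0 < t)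
    {B : ι → ℝ} {I : Set ι} (h : ∀ i ∈ I, s * A < t * B i) :
    ∃ ε, 0 < ε ∧ ε < 1 ∧ ε < t ∧ ∀ i ∈ I, (s + ε) * A < (t - ε) * B i := by
  have hlim (i : ι) (hi : i ∈ I) :
      ∀ᶠ ε in nhdsWithin 0 (Set.Ioi 0), (s + ε) * A < (t - ε) * B i :=
    Filter.Eventually.filter_mono nhdsWithin_le_nhds <|
      ContinuousAt.eventually_lt (by fun_prop) (by fun_prop) (by simpa using h i hi)
  have hev : ∀ᶠ ε in nhdsWithin 0 (Set.Ioi 0), ∀ i ∈ I, (s + ε) * A < (t - ε) * B i :=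
    eventually_all.2 fun i => eventually_imp_distrib_left.2 (hlim i)
  obtain ⟨ε, hε, hlt⟩ := (hev.and (Ioo_mem_nhdsGT (lt_min one_pos ht))).exists
  exact ⟨ε, hlt.1, (lt_min_iff.1 hlt.2).1, (lt_min_iff.1 hlt.2).2, hε⟩

variable {p : Fin M → ℝ} {μc wc : Fin M → Vec d} {σx σy : ℝ}

theorem exists_iclRisk_le_risingTerm (hp : ∀ m, 0 < p m) (hsum : ∑ m, p m = 1) (hσx : 0 < σx)
    (hσy : 0 < σy) {μs ws : Vec d} {τ : ℝ} (hτ : 0 < τ) (hμs : ‖μs‖ ≤ 1) (α : Fin M) {dμ uw : ℝ}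
    (hdμ : 0 < dμ) (huw : 0 < uw)
    (hmarginμ : ∀ β, β ≠ α → dμ ^ 2 ≤ ‖μc β - μs‖ ^ 2 - ‖μc α - μs‖ ^ 2)
    (hmarginu : ∀ β, β ≠ α →
      τ ^ 2 * uw ^ 2 ≤ τ ^ 2 * ‖wc β - ws‖ ^ 2 - (1 + τ ^ 2) * ‖wc α - ws‖ ^ 2) :
    ∃ C : ℝ, 0 ≤ C ∧ ∀ σμ σw : ℝ, 0 < σμ → 0 < σw →
      ∀ F : Predictor d, IsOptimalPredictor (taskPrior p μc wc σμ σw) σx σy F →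
      ∀ k : ℕ, (k + 1 : ℕ) * (σμ ^ 2 / σx ^ 2) ≤ 1 →
        iclRisk F μs ws τ (wc α) k ≤
          ENNReal.ofReal (risingTerm (wc α - ws) τ (σw ^ 2 / σy ^ 2) k +
            C * Real.exp (-√k / 8)) := by
  obtain ⟨R, hrange⟩ := (Set.finite_range fun m => ‖wc m - ws‖).bddAbove
  have hR (m : Fin M) : ‖wc m - ws‖ ≤ R := hrange ⟨m, rfl⟩
  obtain ⟨ε, hε, hε1, hετ, hgap⟩ := exists_pos_forall_add_mul_lt_sub_mul (A := ‖wc α - ws‖ ^ 2)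
    (s := 1 + τ ^ 2) (B := fun β => ‖wc β - ws‖ ^ 2) (I := {β | β ≠ α})
    (show 0 < τ ^ 2 by positivity) fun β hβ => by
      have hu : 0 < τ ^ 2 * uw ^ 2 := by positivity
      linarith [hmarginu β hβ]
  obtain ⟨K₁, hK₁, hexp⟩ := exists_exp_neg_succ_mul_le (c := dμ ^ 2 / (8 * σx ^ 2)) (by positivity)
  obtain ⟨K₂, hK₂, hrisk⟩ := exists_iclRisk_le_of_concentrated hμs τ (fun β => μc β - μc α) hε
    (show 0 < dμ ^ 2 / 4 by positivity) (sq_nonneg (2 * R))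
  have hpα := hp α
  refine ⟨M * ((p α)⁻¹ * K₁ * (2 * R) ^ 2) * (1 + d * τ ^ 2) + K₂, by positivity,
    fun σμ σw hσμ hσw F hF k hk => ?_⟩
  have hprompt (x : Fin (k + 1) → Vec d) hlower hupper hmean :=
    hF.promptError_sq_le_of_margin hp hsum hσμ hσw hσx hσy hR α x (a := k * (τ ^ 2 - ε))
      (b := k * (1 + τ ^ 2 + ε)) (mul_nonneg (Nat.cast_nonneg k) (sub_nonneg.2 hετ.le))
      (by gcongr; linarith) hlower hupper
      (fun β hβ => by simpa only [mul_assoc] using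
        mul_le_mul_of_nonneg_left (hgap β hβ).le (Nat.cast_nonneg k))
      (sq_nonneg dμ) hmarginμ hmean hk
  refine (hrisk F ws (wc α) k _ (by positivity) hprompt
    (hF.promptError_sq_le hp hsum hσμ hσw hσx hσy hR α)).trans (ENNReal.ofReal_le_ofReal ?_)
  have hridge : (σw ^ 2 / σy ^ 2 * (k * (1 + τ ^ 2 + ε))) ^ 2 ≤
      4 * (k : ℝ) ^ 2 * (σw ^ 2 / σy ^ 2) ^ 2 * (1 + τ ^ 2) ^ 2 := by
    calc (σw ^ 2 / σy ^ 2 * (k * (1 + τ ^ 2 + ε))) ^ 2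
        ≤ (σw ^ 2 / σy ^ 2 * (k * (2 * (1 + τ ^ 2)))) ^ 2 := by
          gcongr
          linarith [sq_nonneg τ]
      _ = _ := by ring
  calc _ ≤ (‖wc α - ws‖ ^ 2 *
            min 1 (4 * (k : ℝ) ^ 2 * (σw ^ 2 / σy ^ 2) ^ 2 * (1 + τ ^ 2) ^ 2) +
          M * ((p α)⁻¹ * (K₁ * Real.exp (-√k / 8)) * (2 * R) ^ 2)) * (1 + d * τ ^ 2) +
        K₂ * Real.exp (-√k / 8) := by
          gcongr
          exact hexp k
    _ = _ := by
        rw [risingTerm]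
        ring

theorem exists_iclRisk_le_add_inv (hp : ∀ m, 0 < p m) (hsum : ∑ m, p m = 1) (hσx : 0 < σx)
    (hσy : 0 < σy) {μs : Vec d} (ws : Vec d) {τ : ℝ} (hτ : 0 < τ) (hμs : ‖μs‖ ≤ 1) (α : Fin M) :
    ∃ C D K : ℝ, 0 ≤ C ∧ 0 ≤ D ∧ 0 ≤ K ∧ ∀ σμ σw : ℝ, 0 < σμ → 0 < σw →
      ∀ F : Predictor d, IsOptimalPredictor (taskPrior p μc wc σμ σw) σx σy F →
      ∀ k : ℕ, 0 < k →
        iclRisk F μs ws τ (wc α) k ≤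
          ENNReal.ofReal (‖wc α - ws‖ ^ 2 * (1 + d * τ ^ 2) + C / (k * (σw ^ 2 / σy ^ 2)) +
            D / (k * (σw ^ 2 / σy ^ 2)) ^ 2 + K * Real.exp (-√k / 8)) := by
  obtain ⟨R, hrange⟩ := (Set.finite_range fun m => ‖wc m - ws‖).bddAbove
  have hR (m : Fin M) : ‖wc m - ws‖ ≤ R := hrange ⟨m, rfl⟩
  have hR0 : 0 ≤ R := (norm_nonneg _).trans (hR α)
  obtain ⟨K, hK, hrisk⟩ := exists_iclRisk_le_of_concentrated hμs τ Empty.elim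
    (show 0 < τ ^ 2 / 2 by positivity) one_pos (sq_nonneg (2 * R))
  refine ⟨(‖wc α - ws‖ ^ 2 + (2 * R / τ ^ 2) ^ 2) * (1 + d * τ ^ 2),
    (2 * R / τ ^ 2) ^ 2 * (1 + d * τ ^ 2), K, by positivity, by positivity, hK,
    fun σμ σw hσμ hσw F hF k hk => ?_⟩
  set s := k * (σw ^ 2 / σy ^ 2) with hs
  have hs0 : 0 < s := by positivity
  have hshrink : R / (1 + σw ^ 2 / σy ^ 2 * (k * (τ ^ 2 - τ ^ 2 / 2))) ≤ 2 * R / τ ^ 2 / s := by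
    calc _ = R / (1 + s * τ ^ 2 / 2) := by rw [hs]; ring
      _ ≤ R / (s * τ ^ 2 / 2) := by gcongr; linarith
      _ = 2 * R / τ ^ 2 / s := by field_simp
  refine (hrisk F ws (wc α) k
    ((1 + s⁻¹) * ‖wc α - ws‖ ^ 2 + (1 + s) * (2 * R / τ ^ 2 / s) ^ 2) (by positivity)
    (fun x hlower _ _ => ?_) (hF.promptError_sq_le hp hsum hσμ hσw hσx hσy hR α)).trans
    (ENNReal.ofReal_le_ofReal (le_of_eq ?_))
  · have hgood := hF.promptError_sq_le_of_lower_bound hp hsum hσμ hσw hσx hσy hR (wc α) x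
      (mul_nonneg (Nat.cast_nonneg k) (by linarith [sq_nonneg τ])) hlower (inv_pos.2 hs0)
    rw [inv_inv] at hgood
    refine hgood.trans ?_
    have hlen : 0 ≤ τ ^ 2 - τ ^ 2 / 2 := by linarith [sq_nonneg τ]
    gcongr
  · field_simp
    ring

end RiskBounds

section DominantTerms

variable {d : ℕ}

lemma isBigO_exp_neg_sqrt :
    (fun k : ℕ => Real.exp (-√k / 8)) =O[atTop] fun k : ℕ => (k : ℝ) ^ (-2 : ℤ) := by
  have hsqrt : Tendsto (fun k : ℕ => √(k : ℝ)) atTop atTop :=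
    Real.tendsto_sqrt_atTop.comp tendsto_natCast_atTop_atTop
  refine (((isLittleO_exp_neg_mul_rpow_atTop (show (0 : ℝ) < 1 / 8 by norm_num) (-4)).comp_tendsto
    hsqrt).isBigO.congr_left fun k => ?_).trans_eventuallyEq
    (Eventually.of_forall fun k => ?_)
  · simp only [Function.comp_apply]
    ring_nf
  · simp only [Function.comp_apply]
    rw [Real.sqrt_eq_rpow, ← Real.rpow_mul (Nat.cast_nonneg k), ← Real.rpow_intCast]
    norm_num

lemma monotone_risingTerm (e : Vec d) (τ δw : ℝ) : Monotone (risingTerm e τ δw) := by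
  intro k l hkl
  unfold risingTerm
  gcongr

lemma risingTerm_nonneg (e : Vec d) (τ δw : ℝ) (k : ℕ) : 0 ≤ risingTerm e τ δw k := by
  unfold risingTerm
  positivity

lemma risingTerm_le {τ δw : ℝ} (hδw0 : 0 ≤ δw) (hδw1 : δw ≤ 1) (e : Vec d) {k N : ℕ}
    (hk : k ≤ N) :
    risingTerm e τ δw k ≤
      ‖e‖ ^ 2 * (1 + d * τ ^ 2) * (4 * (N : ℝ) ^ 2 * (1 + τ ^ 2) ^ 2) * δw := by
  calc risingTerm e τ δw k
      ≤ ‖e‖ ^ 2 * (1 + d * τ ^ 2) * (4 * (k : ℝ) ^ 2 * δw ^ 2 * (1 + τ ^ 2) ^ 2) :=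
        mul_le_mul_of_nonneg_left (min_le_right _ _) (by positivity)
    _ ≤ ‖e‖ ^ 2 * (1 + d * τ ^ 2) * (4 * (N : ℝ) ^ 2 * δw * (1 + τ ^ 2) ^ 2) := by
        gcongr
        exact pow_le_of_le_one hδw0 hδw1 two_ne_zero
    _ = _ := by ring

lemma decayingTerms_eq (C₃ C₄ dμ uw σx σy τ : ℝ) (k : ℕ) :
    decayingTerms C₃ C₄ dμ uw σx σy τ k =
      C₃ * Real.exp (-(k * (dμ ^ 2 / (8 * σx ^ 2) + uw ^ 2 * τ ^ 2 / (8 * σy ^ 2)))) +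
        C₄ * Real.exp (-√k / 8) := by
  rw [decayingTerms, Real.sqrt_eq_rpow, neg_mul]

lemma mul_exp_neg_sqrt_lt_decayingTerms {C₃ : ℝ} (hC₃ : 0 < C₃) (C₄ dμ uw σx σy τ : ℝ) (k : ℕ) :
    C₄ * Real.exp (-√k / 8) < decayingTerms C₃ C₄ dμ uw σx σy τ k := by
  rw [decayingTerms_eq]
  exact lt_add_of_pos_left _ (by positivity)

lemma tendsto_decayingTerms (C₃ C₄ : ℝ) {dμ σx : ℝ} (hdμ : 0 < dμ) (hσx : 0 < σx)
    (uw σy τ : ℝ) : Tendsto (decayingTerms C₃ C₄ dμ uw σx σy τ) atTop (nhds 0) := by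
  rw [funext (decayingTerms_eq C₃ C₄ dμ uw σx σy τ)]
  have hrate : 0 < dμ ^ 2 / (8 * σx ^ 2) + uw ^ 2 * τ ^ 2 / (8 * σy ^ 2) := by positivity
  have hexp := Real.tendsto_exp_neg_atTop_nhds_zero.comp
    (tendsto_natCast_atTop_atTop.atTop_mul_const hrate)
  have hsqrt : Tendsto (fun k : ℕ => Real.exp (-√k / 8)) atTop (nhds 0) :=
    isBigO_exp_neg_sqrt.trans_tendsto
      ((tendsto_zpow_atTop_zero (by norm_num)).comp tendsto_natCast_atTop_atTop)
  simpa using (hexp.const_mul C₃).add (hsqrt.const_mul C₄)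

lemma eventually_decayingTerms_lt_risingTerm (C₃ C₄ : ℝ) {dμ σx : ℝ} (hdμ : 0 < dμ) (hσx : 0 < σx)
    (uw σy : ℝ) {τ δw : ℝ} (hδw : 0 < δw) {e : Vec d} (he : e ≠ 0) :
    ∀ᶠ k : ℕ in atTop, decayingTerms C₃ C₄ dμ uw σx σy τ k < risingTerm e τ δw k := by
  have hpos : 0 < risingTerm e τ δw 1 := by
    unfold risingTerm
    positivity
  filter_upwards [(tendsto_decayingTerms C₃ C₄ hdμ hσx uw σy τ).eventually_lt_const hpos,
    eventually_ge_atTop 1] with k hk hk1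
  exact hk.trans_le (monotone_risingTerm e τ δw hk1)

lemma natCast_le_min_one_div {δμ δw τ : ℝ} (hδμ : 0 < δμ) (hδw : 0 < δw) (hτ : 0 < τ) {k N : ℕ}
    (hk : k ≤ N) (hμ : δμ < 1 / (N + 1)) (hw : δw < 1 / ((N + 1) * τ ^ 2)) :
    (k : ℝ) ≤ min (1 / δμ - 1) (1 / (δw * τ ^ 2)) := by
  have hkN : (k : ℝ) ≤ N := by exact_mod_cast hk
  refine le_min ?_ ?_
  · linarith [(lt_one_div hδμ (by positivity)).1 hμ]
  · rw [lt_div_iff₀ (by positivity)] at hw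
    rw [le_div_iff₀ (by positivity)]
    calc (k : ℝ) * (δw * τ ^ 2) ≤ (N + 1) * (δw * τ ^ 2) := by gcongr; linarith
      _ = δw * ((N + 1) * τ ^ 2) := by ring
      _ ≤ 1 := hw.le

lemma exists_risingTerm_lt_decayingTerms {C₃ C₄ : ℝ} (hC₃ : 0 < C₃) (hC₄ : 0 < C₄)
    (dμ uw σx σy : ℝ) {τ : ℝ} (hτ : 0 < τ) (e : Vec d) (N : ℕ) :
    ∃ ε : ℝ, 0 < ε ∧ ∀ δμ δw : ℝ, 0 < δμ → 0 < δw → δμ < ε → δw < ε → ∀ k : ℕ, k ≤ N →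
      (k : ℝ) ≤ min (1 / δμ - 1) (1 / (δw * τ ^ 2)) ∧
        risingTerm e τ δw k < decayingTerms C₃ C₄ dμ uw σx σy τ k := by
  obtain ⟨c, hc, hcA⟩ := exists_pos_mul_lt
    (show 0 < C₄ * Real.exp (-√N / 8) by positivity)
    (‖e‖ ^ 2 * (1 + d * τ ^ 2) * (4 * (N : ℝ) ^ 2 * (1 + τ ^ 2) ^ 2))
  refine ⟨min (1 / (N + 1)) (min (1 / ((N + 1) * τ ^ 2)) (min 1 c)), by positivity,
    fun δμ δw hδμ hδw hμ hw k hk => ?_⟩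
  simp only [lt_min_iff] at hμ hw
  refine ⟨natCast_le_min_one_div hδμ hδw hτ hk hμ.1 hw.2.1, ?_⟩
  calc risingTerm e τ δw k
      ≤ ‖e‖ ^ 2 * (1 + d * τ ^ 2) * (4 * (N : ℝ) ^ 2 * (1 + τ ^ 2) ^ 2) * δw :=
        risingTerm_le hδw.le hw.2.2.1.le e hk
    _ ≤ ‖e‖ ^ 2 * (1 + d * τ ^ 2) * (4 * (N : ℝ) ^ 2 * (1 + τ ^ 2) ^ 2) * c := by
        gcongr
        exact hw.2.2.2.le
    _ < C₄ * Real.exp (-√N / 8) := hcA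
    _ ≤ C₄ * Real.exp (-√k / 8) := by gcongr
    _ < decayingTerms C₃ C₄ dμ uw σx σy τ k := mul_exp_neg_sqrt_lt_decayingTerms hC₃ ..

end DominantTerms

section StrictBounds

variable {d M : ℕ} {p : Fin M → ℝ} {μc wc : Fin M → Vec d} {σx σy : ℝ}

theorem exists_eventually_iclRisk_lt (hp : ∀ m, 0 < p m) (hsum : ∑ m, p m = 1) (hσx : 0 < σx)
    (hσy : 0 < σy) {μs : Vec d} (ws : Vec d) {τ : ℝ} (hτ : 0 < τ) (hμs : ‖μs‖ ≤ 1) (α : Fin M) :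
    ∃ C : ℝ, 0 < C ∧ ∀ σμ σw : ℝ, 0 < σμ → 0 < σw →
      ∀ F : Predictor d, IsOptimalPredictor (taskPrior p μc wc σμ σw) σx σy F →
      ∃ g : ℕ → ℝ, g =O[atTop] (fun k : ℕ => (k : ℝ) ^ (-2 : ℤ)) ∧
        ∀ᶠ k : ℕ in atTop,
          iclRisk F μs ws τ (wc α) k <
            ENNReal.ofReal (‖wc α - ws‖ ^ 2 * (1 + d * τ ^ 2) +
              C / (k * (σw ^ 2 / σy ^ 2)) + g k) := by
  obtain ⟨C, D, K, hC, hD, hK, hrisk⟩ :=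
    exists_iclRisk_le_add_inv hp hsum (μc := μc) (wc := wc) hσx hσy ws hτ hμs α
  refine ⟨C + 1, by positivity, fun σμ σw hσμ hσw F hF =>
    ⟨fun k => D / (k * (σw ^ 2 / σy ^ 2)) ^ 2 + K * Real.exp (-√k / 8), ?_, ?_⟩⟩
  · refine IsBigO.add ?_ (isBigO_exp_neg_sqrt.const_mul_left K)
    refine ((isBigO_refl _ _).const_mul_left (D / (σw ^ 2 / σy ^ 2) ^ 2)).congr_left fun k => ?_
    rw [zpow_neg, zpow_ofNat, mul_pow]
    ring
  · filter_upwards [eventually_gt_atTop 0] with k hk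
    refine (hrisk σμ σw hσμ hσw F hF k hk).trans_lt
      ((ENNReal.ofReal_lt_ofReal_iff (by positivity)).2 ?_)
    have hslack : 0 < 1 / (k * (σw ^ 2 / σy ^ 2)) := by positivity
    rw [add_div]
    linarith

theorem exists_iclRisk_lt_risingTerm_add (hp : ∀ m, 0 < p m) (hsum : ∑ m, p m = 1) (hσx : 0 < σx)
    (hσy : 0 < σy) {μs ws : Vec d} {τ : ℝ} (hτ : 0 < τ) (hμs : ‖μs‖ ≤ 1) (α : Fin M) {dμ uw : ℝ}
    (hdμ : 0 < dμ) (huw : 0 < uw)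
    (hmarginμ : ∀ β, β ≠ α → dμ ^ 2 ≤ ‖μc β - μs‖ ^ 2 - ‖μc α - μs‖ ^ 2)
    (hmarginu : ∀ β, β ≠ α →
      τ ^ 2 * uw ^ 2 ≤ τ ^ 2 * ‖wc β - ws‖ ^ 2 - (1 + τ ^ 2) * ‖wc α - ws‖ ^ 2) :
    ∃ C₃ C₄ : ℝ, 0 < C₃ ∧ 0 < C₄ ∧ ∀ σμ σw : ℝ, 0 < σμ → 0 < σw →
      ∀ F : Predictor d, IsOptimalPredictor (taskPrior p μc wc σμ σw) σx σy F →
      ∀ k : ℕ, (k : ℝ) ≤ 1 / (σμ ^ 2 / σx ^ 2) - 1 →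
        iclRisk F μs ws τ (wc α) k <
          ENNReal.ofReal (risingTerm (wc α - ws) τ (σw ^ 2 / σy ^ 2) k +
            decayingTerms C₃ C₄ dμ uw σx σy τ k) := by
  obtain ⟨C, hC, hrisk⟩ :=
    exists_iclRisk_le_risingTerm hp hsum hσx hσy hτ hμs α hdμ huw hmarginμ hmarginu
  refine ⟨1, C + 1, one_pos, by positivity, fun σμ σw hσμ hσw F hF k hk => ?_⟩
  have hk' : (k + 1 : ℕ) * (σμ ^ 2 / σx ^ 2) ≤ 1 := by
    rw [← le_div_iff₀ (by positivity)]
    push_cast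
    linarith
  refine (hrisk σμ σw hσμ hσw F hF k hk').trans_lt
    ((ENNReal.ofReal_lt_ofReal_iff_of_nonneg ?_).2 ?_)
  · exact add_nonneg (risingTerm_nonneg ..) (by positivity)
  · gcongr
    calc C * Real.exp (-√k / 8) ≤ (C + 1) * Real.exp (-√k / 8) := by gcongr; linarith
      _ < decayingTerms 1 (C + 1) dμ uw σx σy τ k := mul_exp_neg_sqrt_lt_decayingTerms one_pos ..

end StrictBounds

end ICL

end

theorem theorem3_general {d M : ℕ}
    (p : Fin M → ℝ) (μc wc : Fin M → ICL.Vec d) (σx σy : ℝ)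
    (hp_pos : ∀ m, 0 < p m) (hp_sum : ∑ m, p m = 1)
    (hσx : 0 < σx) (hσy : 0 < σy)
    (μs ws : ICL.Vec d) (τ : ℝ) (hτ : 0 < τ) (hμs : ‖μs‖ ≤ 1)
    (α : Fin M) (hbias : ws ≠ wc α)
    (dμ uw : ℝ) (hdμ : 0 < dμ) (huw : 0 < uw)
    (hmarginμ : ∀ β, β ≠ α → dμ ^ 2 ≤ ‖μc β - μs‖ ^ 2 - ‖μc α - μs‖ ^ 2)
    (hmarginu : ∀ β, β ≠ α →
      τ ^ 2 * uw ^ 2 ≤ τ ^ 2 * ‖wc β - ws‖ ^ 2 - (1 + τ ^ 2) * ‖wc α - ws‖ ^ 2) :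
    ∃ C₁ C₂ C₃ C₄ : ℝ, 0 < C₁ ∧ 0 < C₂ ∧ 0 < C₃ ∧ 0 < C₄ ∧
      (∀ σμ σw : ℝ, 0 < σμ → 0 < σw →
        ∀ F : ICL.Predictor d, ICL.IsOptimalPredictor (ICL.taskPrior p μc wc σμ σw) σx σy F →
        ∀ δ : ℝ,
        ∃ g : ℕ → ℝ, g =O[atTop] (fun k : ℕ => (k : ℝ) ^ (-2 : ℤ)) ∧
          ∀ᶠ k : ℕ in atTop,
            ICL.iclRisk F μs ws τ (wc α) k <
              ENNReal.ofReal (‖wc α - ws‖ ^ 2 * (1 + d * τ ^ 2) +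
                C₁ / (k * (σw ^ 2 / σy ^ 2)) * Real.exp (C₂ * (k : ℝ) ^ (δ / 2 - 3 / 4)) +
                g k)) ∧
      (∀ σμ σw : ℝ, 0 < σμ → 0 < σw →
        ∀ F : ICL.Predictor d, ICL.IsOptimalPredictor (ICL.taskPrior p μc wc σμ σw) σx σy F →
        ∀ k : ℕ,
          (k : ℝ) ≤ 1 / (σμ ^ 2 / σx ^ 2) - 1 →
            ICL.iclRisk F μs ws τ (wc α) k <
              ENNReal.ofReal (ICL.risingTerm (wc α - ws) τ (σw ^ 2 / σy ^ 2) k +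
                ICL.decayingTerms C₃ C₄ dμ uw σx σy τ k)) ∧
      (∀ N : ℕ, ∃ ε : ℝ, 0 < ε ∧ ∀ σμ σw : ℝ, 0 < σμ → 0 < σw →
        σμ ^ 2 / σx ^ 2 < ε → σw ^ 2 / σy ^ 2 < ε →
        ∀ k : ℕ, k ≤ N →
          (k : ℝ) ≤ min (1 / (σμ ^ 2 / σx ^ 2) - 1) (1 / (σw ^ 2 / σy ^ 2 * τ ^ 2)) ∧
          ICL.risingTerm (wc α - ws) τ (σw ^ 2 / σy ^ 2) k <
            ICL.decayingTerms C₃ C₄ dμ uw σx σy τ k) ∧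
      (∀ σw : ℝ, 0 < σw → Monotone (ICL.risingTerm (wc α - ws) τ (σw ^ 2 / σy ^ 2)) ∧
        ∀ᶠ k : ℕ in atTop,
          ICL.decayingTerms C₃ C₄ dμ uw σx σy τ k <
            ICL.risingTerm (wc α - ws) τ (σw ^ 2 / σy ^ 2) k) := by
  obtain ⟨C₁, hC₁, hasymp⟩ :=
    ICL.exists_eventually_iclRisk_lt (μc := μc) (wc := wc) hp_pos hp_sum hσx hσy ws hτ hμs α
  obtain ⟨C₃, C₄, hC₃, hC₄, hshort⟩ := ICL.exists_iclRisk_lt_risingTerm_add hp_pos hp_sum hσx hσy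
    hτ hμs α hdμ huw hmarginμ hmarginu
  refine ⟨C₁, 1, C₃, C₄, hC₁, one_pos, hC₃, hC₄, fun σμ σw hσμ hσw F hF δ => ?_, hshort,
    fun N => ?_, fun σw hσw => ⟨ICL.monotone_risingTerm _ _ _,
      ICL.eventually_decayingTerms_lt_risingTerm _ _ hdμ hσx uw σy (by positivity)
        (sub_ne_zero.2 hbias.symm)⟩⟩
  · obtain ⟨g, hg, hlt⟩ := hasymp σμ σw hσμ hσw F hF
    refine ⟨g, hg, hlt.mono fun k hk => hk.trans_le (ENNReal.ofReal_le_ofReal ?_)⟩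
    gcongr
    exact le_mul_of_one_le_right (by positivity) (Real.one_le_exp (by positivity))
  · obtain ⟨ε, hε, hdom⟩ :=
      ICL.exists_risingTerm_lt_decayingTerms hC₃ hC₄ dμ uw σx σy hτ (wc α - ws) N
    exact ⟨ε, hε, fun σμ σw hσμ hσw => hdom _ _ (by positivity) (by positivity)⟩

theorem theorem3 {d M : ℕ}
    -- mixture weights and centers of the task prior, sample noise scales
    (p : Fin M → ℝ) (μc wc : Fin M → ICL.Vec d) (σx σy : ℝ)
    (hp_pos : ∀ m, 0 < p m) (hp_lt : ∀ m, p m < 1) (hp_sum : ∑ m, p m = 1)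
    (hμc : ∀ m, ‖μc m‖ = 1) (hwc : ∀ m, ‖wc m‖ = 1)
    (hσx : 0 < σx) (hσy : 0 < σy)
    -- in-context task
    (μs ws : ICL.Vec d) (τ : ℝ) (hτ : 0 < τ) (hμs : ‖μs‖ = 1) (hws : ‖ws‖ = 1)
    -- biased labels and margins
    (α : Fin M) (hbias : ws ≠ wc α)
    (dμ dw uw : ℝ) (hdμ : 0 < dμ) (hdw : 0 < dw) (huw : 0 < uw)
    (hmarginμ : ∀ β, β ≠ α → dμ ^ 2 ≤ ‖μc β - μs‖ ^ 2 - ‖μc α - μs‖ ^ 2)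
    (hmarginw : ∀ β, β ≠ α → dw ^ 2 ≤ ‖wc β - ws‖ ^ 2 - ‖wc α - ws‖ ^ 2)
    (hmarginu : ∀ β, β ≠ α →
      τ ^ 2 * uw ^ 2 ≤ τ ^ 2 * ‖wc β - ws‖ ^ 2 - (1 + τ ^ 2) * ‖wc α - ws‖ ^ 2) :
    -- the constants depend neither on the task noises `σμ, σw` nor on `δ`, `k`
    ∃ C₁ C₂ C₃ C₄ : ℝ, 0 < C₁ ∧ 0 < C₂ ∧ 0 < C₃ ∧ 0 < C₄ ∧
      -- asymptotic bound
      (∀ σμ σw : ℝ, 0 < σμ → 0 < σw →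
        ∀ F : ICL.Predictor d, ICL.IsOptimalPredictor (ICL.taskPrior p μc wc σμ σw) σx σy F →
        ∀ δ : ℝ, 0 < δ → δ < 1 / 2 →
        ∃ g : ℕ → ℝ, g =O[atTop] (fun k : ℕ => (k : ℝ) ^ (-2 : ℤ)) ∧
          ∀ᶠ k : ℕ in atTop,
            ICL.iclRisk F μs ws τ (wc α) k <
              ENNReal.ofReal (‖wc α - ws‖ ^ 2 * (1 + d * τ ^ 2) +
                C₁ / (k * (σw ^ 2 / σy ^ 2)) * Real.exp (C₂ * (k : ℝ) ^ (δ / 2 - 3 / 4)) +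
                g k)) ∧
      -- bound on the interval `k ≤ min {1 / δμ - 1, 1 / (δw τ²)}`
      (∀ σμ σw : ℝ, 0 < σμ → 0 < σw →
        ∀ F : ICL.Predictor d, ICL.IsOptimalPredictor (ICL.taskPrior p μc wc σμ σw) σx σy F →
        ∀ k : ℕ,
          (k : ℝ) ≤ min (1 / (σμ ^ 2 / σx ^ 2) - 1) (1 / (σw ^ 2 / σy ^ 2 * τ ^ 2)) →
            ICL.iclRisk F μs ws τ (wc α) k <
              ENNReal.ofReal (ICL.risingTerm (wc α - ws) τ (σw ^ 2 / σy ^ 2) k +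
                ICL.decayingTerms C₃ C₄ dμ uw σx σy τ k)) ∧
      -- for small `δμ` and `δw`, the interval contains any prescribed initial segment, on which
      -- the decaying terms dominate the bound
      (∀ N : ℕ, ∃ ε : ℝ, 0 < ε ∧ ∀ σμ σw : ℝ, 0 < σμ → 0 < σw →
        σμ ^ 2 / σx ^ 2 < ε → σw ^ 2 / σy ^ 2 < ε →
        ∀ k : ℕ, k ≤ N →
          (k : ℝ) ≤ min (1 / (σμ ^ 2 / σx ^ 2) - 1) (1 / (σw ^ 2 / σy ^ 2 * τ ^ 2)) ∧
          ICL.risingTerm (wc α - ws) τ (σw ^ 2 / σy ^ 2) k <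
            ICL.decayingTerms C₃ C₄ dμ uw σx σy τ k) ∧
      -- for large `k` the non-decreasing term dominates the bound
      (∀ σw : ℝ, 0 < σw → Monotone (ICL.risingTerm (wc α - ws) τ (σw ^ 2 / σy ^ 2)) ∧
        ∀ᶠ k : ℕ in atTop,
          ICL.decayingTerms C₃ C₄ dμ uw σx σy τ k <
            ICL.risingTerm (wc α - ws) τ (σw ^ 2 / σy ^ 2) k) := by
  obtain ⟨C₁, C₂, C₃, C₄, hC₁, hC₂, hC₃, hC₄, hasymp, hshort, hdom⟩ :=
    theorem3_general p μc wc σx σy hp_pos hp_sum hσx hσy μs ws τ hτ hμs.le α hbias dμ uw hdμ huw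
      hmarginμ hmarginu
  exact ⟨C₁, C₂, C₃, C₄, hC₁, hC₂, hC₃, hC₄,
    fun σμ σw hσμ hσw F hF δ _ _ => hasymp σμ σw hσμ hσw F hF δ,
    fun σμ σw hσμ hσw F hF k hk => hshort σμ σw hσμ hσw F hF k (hk.trans (min_le_left _ _)), hdom⟩
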